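/- Let $n\ge 1$, let $M\in\mathbb R^{n\times n}$ be symmetric, $q\in\mathbb R^n$ and $u\in(0,\infty]^n$, and consider the quadratic program $$\text{(QP)}\qquad \min_{0\le x\le u}\ \theta(x)=q^\top x+\tfrac12x^\top Mx .$$ The comparison matrix $\overline M$ of $M$ has entries $\overline M_{ii}=m_{ii}$ and $\overline M_{ij}=-|m_{ij}|$ for $i\ne j$. The matrix $M$ is irreducible if no permutation matrix $P$ brings $PMP^\top$ to the form $\begin{bmatrix}B&0\\C&D\end{bmatrix}$ with square nonempty blocks $B,D$. **The algorithm (PPPA)** for a vector $p\in\mathbb R^n$. It works with a partition $(\alpha,\beta,\gamma)$ of $[n]=\{1,\dots,n\}$, initially $(\emptyset,[n],\emptyset)$. In each iteration it computes $\bar p_\alpha=M_{\alpha\alpha}^{-1}p_\alpha$, $\bar q_\alpha=M_{\alpha\alpha}^{-1}(q_\alpha+M_{\alpha\gamma}u_\gamma)$ and, for $i\notin\alpha$, $\bar p_i=p_i-M_{i\alpha}\bar p_\alpha$, $\bar q_i=q_i+M_{i\gamma}u_\gamma-M_{i\alpha}\bar q_\alpha$, and then $$\tau=\max\Big(\{0\}\cup\big\{-\tfrac{\bar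 q_i}{\bar p_i}: i\in\beta,\ \bar p_i>0\big\}\cup\big\{-\tfrac{u_i+\bar q_i}{\bar p_i}: i\in\alpha,\ \bar p_i>0,\ u_i<\infty\big\}\Big).$$ If $\tau=0$, it stops and returns $(x_\alpha,x_\beta,x_\gamma)=(-\bar q_\alpha,0,u_\gamma)$. Otherwise it chooses an index $i$ attaining the maximum (ties here and below are broken arbitrarily) and pivots: 1. if $i\in\alpha$, then $i$ moves from $\alpha$ to $\gamma$; 2. if $i\in\beta$, let $\hat m=M_{\alpha\alpha}^{-1}M_{\alpha i}$ and $\sigma=m_{ii}-M_{i\alpha}\hat m$ (the Schur complement entry). - (2a) If $\sigma>0$, then $i$ moves from $\beta$ to $\alpha$. - (2b) If $\sigma=0$, let $\rho$ be the minimum of the numbers $\frac{-\bar q_j-\tau\bar p_j}{\hat m_j}$ ($j\in\alpha$, $\hat m_j>0$), $\frac{u_j+\bar q_j+\tau\bar p_j}{-\hat m_j}$ ($j\in\alpha$, $u_j<\infty$, $\hat m_j<0$), and $u_i$ if $u_i<\infty$. If there are none ($\rho=\infty$), it stops and reports that (QP) has no finite optimal solution. Otherwise, if $\rho=u_i$,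 then $i$ moves from $\beta$ to $\gamma$; if $\rho$ is attained by an index $j$ of the first (second) family, then $i$ moves from $\beta$ to $\alpha$ and $j$ moves from $\alpha$ to $\beta$ (to $\gamma$). **Theorem.** Suppose that $M$ is irreducible and $\overline M$ is positive semidefinite, let $d>0$ satisfy $\overline Md=0$, put $p=Md$, and suppose that $q+\tau_0p\ge0$ for some $\tau_0>0$. Then, however ties are broken, the PPPA is well defined (each $M_{\alpha\alpha}$ that occurs is nonsingular, and the algorithm never gets stuck), all its pivots are of the kinds (1) and (2a), and after at most $2n$ pivots it stops. If it stops with a vector $x$, then $x$ is an optimal solution of (QP); if it stops with the report that (QP) has no finite optimal solution, then (QP) has none and $\theta$ is unbounded below on the box. Moreover the PPPA has overall complexity $O(n^3)$: there are a single program of a random access machine with unit-cost real arithmetic and comparisons, and a constant $C$, such that for all $n\ge1$ and all data $M,q,u,d$ as above the program carries out a complete run of the PPPA (recording its partitions $(\alpha,\beta,\gamma)$ and its result) in at most $Cn^3$ steps. -/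

import Mathlib

namespace PPPA

/-! ### Matrices -/

/-- The comparison matrix: same diagonal, off-diagonal entries `-|m_ij|`. -/
def comparison {n : ℕ} (M : Matrix (Fin n) (Fin n) ℝ) : Matrix (Fin n) (Fin n) ℝ :=
  Matrix.of fun i j => if i = j then M i i else -|M i j|

/-- `A` is irreducible: no simultaneous permutation of rows and columns brings `A` to the form
`[B 0; C D]` with square diagonal blocks `B` (of order `k`, `0 < k < n`) and `D`. -/
def IsIrreducible {n : ℕ} (A : Matrix (Fin n) (Fin n) ℝ) : Prop :=
  ¬ ∃ (e : Equiv.Perm (Fin n)) (k : ℕ), 0 < k ∧ k < n ∧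
    ∀ i j : Fin n, (i : ℕ) < k → k ≤ (j : ℕ) → A.submatrix e e i j = 0

/-! ### The box-constrained quadratic program

Upper bounds lie in `EReal`, so that `u i = ⊤` means that there is no upper bound on `x i`. -/

/-- The objective `q^T x + (1/2) x^T M x`. -/
noncomputable def objective {n : ℕ} (M : Matrix (Fin n) (Fin n) ℝ) (q : Fin n → ℝ)
    (x : Fin n → ℝ) : ℝ :=
  q ⬝ᵥ x + (1 / 2) * (x ⬝ᵥ M.mulVec x)

/-- The box `0 ≤ x ≤ u`. -/
def box {n : ℕ} (u : Fin n → EReal) : Set (Fin n → ℝ) :=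
  {x | ∀ i, 0 ≤ x i ∧ (x i : EReal) ≤ u i}

/-- `x` is an optimal solution of the quadratic program. -/
def IsOptimal {n : ℕ} (M : Matrix (Fin n) (Fin n) ℝ) (q : Fin n → ℝ) (u : Fin n → EReal)
    (x : Fin n → ℝ) : Prop :=
  x ∈ box u ∧ ∀ y ∈ box u, objective M q x ≤ objective M q y

/-! ### The parametric principal pivoting algorithm -/

/-- The position of a variable: nonbasic at its lower bound (index set `β`), basic
(index set `α`), or nonbasic at its upper bound (index set `γ`). -/
inductive Pos
  | lower
  | basic
  | upper
  deriving DecidableEq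

/-- A triple `(α, β, γ)` of index sets that partition `[n]`. -/
abbrev Status (n : ℕ) : Type := Fin n → Pos

/-- Initially `α = γ = ∅` and `β = [n]`. -/
def initial (n : ℕ) : Status n := fun _ => Pos.lower

/-- The principal submatrix `M_αα`. -/
def basicBlock {n : ℕ} (M : Matrix (Fin n) (Fin n) ℝ) (s : Status n) :
    Matrix {i : Fin n // s i = Pos.basic} {i : Fin n // s i = Pos.basic} ℝ :=
  M.submatrix Subtype.val Subtype.val

/-- The vector with `α`-part `M_αα⁻¹ v_α` and with zeros elsewhere. -/
noncomputable def basicSolve {n : ℕ} (M : Matrix (Fin n) (Fin n) ℝ) (s : Status n)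
    (v : Fin n → ℝ) : Fin n → ℝ := fun i =>
  if h : s i = Pos.basic then ((basicBlock M s)⁻¹.mulVec fun j => v j.val) ⟨i, h⟩ else 0

/-- The update of a vector: `v̄_α = M_αα⁻¹ v_α`, and `v̄_i = v_i - M_iα M_αα⁻¹ v_α` for
`i ∉ α`. -/
noncomputable def bar {n : ℕ} (M : Matrix (Fin n) (Fin n) ℝ) (s : Status n)
    (v : Fin n → ℝ) : Fin n → ℝ := fun i =>
  if s i = Pos.basic then basicSolve M s v i else v i - ∑ j, M i j * basicSolve M s v j

/-- The vector `q̄`: the update of `q + M_{·γ} u_γ`. -/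
noncomputable def qbar {n : ℕ} (M : Matrix (Fin n) (Fin n) ℝ) (q : Fin n → ℝ)
    (u : Fin n → EReal) (s : Status n) : Fin n → ℝ :=
  bar M s fun i => q i + ∑ j, if s j = Pos.upper then M i j * (u j).toReal else 0

/-- The column `m̂_{αi} = M_αα⁻¹ M_αi` (with zeros outside `α`). -/
noncomputable def mhat {n : ℕ} (M : Matrix (Fin n) (Fin n) ℝ) (s : Status n) (i : Fin n) :
    Fin n → ℝ :=
  basicSolve M s fun j => M j i

/-- The diagonal entry `(M / M_αα)_ii` of the Schur complement, for `i ∉ α`. -/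
noncomputable def schurDiag {n : ℕ} (M : Matrix (Fin n) (Fin n) ℝ) (s : Status n)
    (i : Fin n) : ℝ :=
  M i i - ∑ j, M i j * mhat M s i j

/-- `i ∈ β` competes in the first ratio test with the ratio `t = -q̄_i / p̄_i`. -/
def LowerRatio {n : ℕ} (M : Matrix (Fin n) (Fin n) ℝ) (q p : Fin n → ℝ) (u : Fin n → EReal)
    (s : Status n) (i : Fin n) (t : ℝ) : Prop :=
  s i = Pos.lower ∧ 0 < bar M s p i ∧ t = -(qbar M q u s i / bar M s p i)

/-- `i ∈ α` competes in the first ratio test with the ratio `t = -(u_i + q̄_i) / p̄_i`. -/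
def UpperRatio {n : ℕ} (M : Matrix (Fin n) (Fin n) ℝ) (q p : Fin n → ℝ) (u : Fin n → EReal)
    (s : Status n) (i : Fin n) (t : ℝ) : Prop :=
  s i = Pos.basic ∧ 0 < bar M s p i ∧ u i < ⊤ ∧
    t = -(((u i).toReal + qbar M q u s i) / bar M s p i)

/-- `t` is the new critical value `τ_new` of the parameter: the maximum of `0` and of all
ratios of the first ratio test. -/
def IsCritical {n : ℕ} (M : Matrix (Fin n) (Fin n) ℝ) (q p : Fin n → ℝ) (u : Fin n → EReal)
    (s : Status n) (t : ℝ) : Prop :=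
  IsGreatest ({0} ∪ {r | ∃ i, LowerRatio M q p u s i r} ∪ {r | ∃ i, UpperRatio M q p u s i r}) t

/-- `j ∈ α` competes in the second ratio test by falling to `0`, with ratio `r`. -/
def DownRatio {n : ℕ} (M : Matrix (Fin n) (Fin n) ℝ) (q p : Fin n → ℝ) (u : Fin n → EReal)
    (s : Status n) (t : ℝ) (i j : Fin n) (r : ℝ) : Prop :=
  s j = Pos.basic ∧ 0 < mhat M s i j ∧
    r = (-qbar M q u s j - t * bar M s p j) / mhat M s i j

/-- `j ∈ α` competes in the second ratio test by rising to `u_j`, with ratio `r`. -/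
def UpRatio {n : ℕ} (M : Matrix (Fin n) (Fin n) ℝ) (q p : Fin n → ℝ) (u : Fin n → EReal)
    (s : Status n) (t : ℝ) (i j : Fin n) (r : ℝ) : Prop :=
  s j = Pos.basic ∧ u j < ⊤ ∧ mhat M s i j < 0 ∧
    r = ((u j).toReal + qbar M q u s j + t * bar M s p j) / (-mhat M s i j)

/-- All candidates of the second ratio test, including `u_i` if finite; the minimum is
`ρ_min`, with `ρ_min = ∞` if there is no candidate. -/
def secondRatios {n : ℕ} (M : Matrix (Fin n) (Fin n) ℝ) (q p : Fin n → ℝ) (u : Fin n → EReal)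
    (s : Status n) (t : ℝ) (i : Fin n) : Set ℝ :=
  {r | ∃ j, DownRatio M q p u s t i j r} ∪ {r | ∃ j, UpRatio M q p u s t i j r} ∪
    {r | u i < ⊤ ∧ r = (u i).toReal}

/-- Names of the five kinds of pivots. -/
inductive Kind
  /-- diagonal pivot, `i` moves from `α` to `γ` -/
  | toUpper
  /-- diagonal pivot, `i` moves from `β` to `α` -/
  | enter
  /-- `2 × 2` pivot, `i` moves from `β` to `γ` -/
  | jump
  /-- `2 × 2` pivot, `i` moves from `β` to `α` and `j` from `α` to `β` -/
  | swapDown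
  /-- `2 × 2` pivot, `i` moves from `β` to `α` and `j` from `α` to `γ` -/
  | swapUp

/-- `Pivot M q p u k s s'`: the algorithm may perform a pivot of kind `k` at the index triple
`s`, with resulting index triple `s'`. Ties are broken arbitrarily. -/
inductive Pivot {n : ℕ} (M : Matrix (Fin n) (Fin n) ℝ) (q p : Fin n → ℝ) (u : Fin n → EReal) :
    Kind → Status n → Status n → Prop
  | toUpper (s : Status n) (t : ℝ) (i : Fin n) :
      IsCritical M q p u s t → 0 < t → UpperRatio M q p u s i t →
      Pivot M q p u Kind.toUpper s (Function.update s i Pos.upper)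
  | enter (s : Status n) (t : ℝ) (i : Fin n) :
      IsCritical M q p u s t → 0 < t → LowerRatio M q p u s i t → 0 < schurDiag M s i →
      Pivot M q p u Kind.enter s (Function.update s i Pos.basic)
  | jump (s : Status n) (t : ℝ) (i : Fin n) :
      IsCritical M q p u s t → 0 < t → LowerRatio M q p u s i t → schurDiag M s i = 0 →
      u i < ⊤ → IsLeast (secondRatios M q p u s t i) (u i).toReal →
      Pivot M q p u Kind.jump s (Function.update s i Pos.upper)
  | swapDown (s : Status n) (t : ℝ) (i j : Fin n) (r : ℝ) :
      IsCritical M q p u s t → 0 < t → LowerRatio M q p u s i t → schurDiag M s i = 0 →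
      DownRatio M q p u s t i j r → IsLeast (secondRatios M q p u s t i) r →
      Pivot M q p u Kind.swapDown s
        (Function.update (Function.update s i Pos.basic) j Pos.lower)
  | swapUp (s : Status n) (t : ℝ) (i j : Fin n) (r : ℝ) :
      IsCritical M q p u s t → 0 < t → LowerRatio M q p u s i t → schurDiag M s i = 0 →
      UpRatio M q p u s t i j r → IsLeast (secondRatios M q p u s t i) r →
      Pivot M q p u Kind.swapUp s
        (Function.update (Function.update s i Pos.basic) j Pos.upper)

/-- The algorithm stops and reports a solution: `τ_new = 0`. -/
def StopsOptimal {n : ℕ} (M : Matrix (Fin n) (Fin n) ℝ) (q p : Fin n → ℝ) (u : Fin n → EReal)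
    (s : Status n) : Prop :=
  IsCritical M q p u s 0

/-- The solution `(x_α, x_β, x_γ) = (-q̄_α, 0, u_γ)` that is reported. -/
noncomputable def solution {n : ℕ} (M : Matrix (Fin n) (Fin n) ℝ) (q : Fin n → ℝ)
    (u : Fin n → EReal) (s : Status n) : Fin n → ℝ := fun i =>
  match s i with
  | Pos.basic => -qbar M q u s i
  | Pos.lower => 0
  | Pos.upper => (u i).toReal

/-- The algorithm stops and reports that there is no finite optimal solution: a `2 × 2` pivot
is called for, and `ρ_min = ∞`. -/
def StopsUnbounded {n : ℕ} (M : Matrix (Fin n) (Fin n) ℝ) (q p : Fin n → ℝ)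
    (u : Fin n → EReal) (s : Status n) : Prop :=
  ∃ t i, IsCritical M q p u s t ∧ 0 < t ∧ LowerRatio M q p u s i t ∧ schurDiag M s i = 0 ∧
    secondRatios M q p u s t i = ∅

/-- `σ 0, …, σ N` are the index triples of `N` successive pivots of the algorithm. -/
def IsRun {n : ℕ} (M : Matrix (Fin n) (Fin n) ℝ) (q p : Fin n → ℝ) (u : Fin n → EReal)
    (N : ℕ) (σ : ℕ → Status n) : Prop :=
  σ 0 = initial n ∧ ∀ k < N, ∃ κ, Pivot M q p u κ (σ k) (σ (k + 1))

/-! ### A random access machine with real arithmetic at unit cost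

A program is a finite text, the same for all dimensions. Every arithmetic operation, every
comparison, every memory access, every assignment and every pass through a loop costs one
step. -/

/-- The memory: natural-number registers, two-dimensional arrays of natural numbers and
two-dimensional arrays of real numbers. -/
structure Mem where
  reg : ℕ → ℕ
  nat : ℕ → ℕ → ℕ → ℕ
  real : ℕ → ℕ → ℕ → ℝ

/-- Assignment to a register. -/
def Mem.setReg (m : Mem) (v k : ℕ) : Mem :=
  { m with reg := Function.update m.reg v k }

/-- Assignment to the entry `(i, j)` of a natural-number array. -/
def Mem.setNat (m : Mem) (a i j k : ℕ) : Mem :=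
  { m with
    nat := Function.update m.nat a
      (Function.update (m.nat a) i (Function.update (m.nat a i) j k)) }

/-- Assignment to the entry `(i, j)` of a real array. -/
def Mem.setReal (m : Mem) (a i j : ℕ) (x : ℝ) : Mem :=
  { m with
    real := Function.update m.real a
      (Function.update (m.real a) i (Function.update (m.real a i) j x)) }

/-- Natural-number expressions. -/
inductive NExp
  | const (k : ℕ)
  | reg (v : ℕ)
  | get (a : ℕ) (i j : NExp)
  | add (e f : NExp)
  | sub (e f : NExp)

/-- Value of a natural-number expression (subtraction is truncated). -/
def NExp.eval (m : Mem) : NExp → ℕ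
  | .const k => k
  | .reg v => m.reg v
  | .get a i j => m.nat a (i.eval m) (j.eval m)
  | .add e f => e.eval m + f.eval m
  | .sub e f => e.eval m - f.eval m

/-- Cost of a natural-number expression. -/
def NExp.cost : NExp → ℕ
  | .const _ => 1
  | .reg _ => 1
  | .get _ i j => i.cost + j.cost + 1
  | .add e f => e.cost + f.cost + 1
  | .sub e f => e.cost + f.cost + 1

/-- Real expressions; the only constants are `0` and `1`. -/
inductive RExp
  | zero
  | one
  | get (a : ℕ) (i j : NExp)
  | add (e f : RExp)
  | sub (e f : RExp)
  | mul (e f : RExp)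
  | div (e f : RExp)

/-- Value of a real expression. -/
noncomputable def RExp.eval (m : Mem) : RExp → ℝ
  | .zero => 0
  | .one => 1
  | .get a i j => m.real a (i.eval m) (j.eval m)
  | .add e f => e.eval m + f.eval m
  | .sub e f => e.eval m - f.eval m
  | .mul e f => e.eval m * f.eval m
  | .div e f => e.eval m / f.eval m

/-- Cost of a real expression. -/
def RExp.cost : RExp → ℕ
  | .zero => 1
  | .one => 1
  | .get _ i j => i.cost + j.cost + 1
  | .add e f => e.cost + f.cost + 1
  | .sub e f => e.cost + f.cost + 1
  | .mul e f => e.cost + f.cost + 1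
  | .div e f => e.cost + f.cost + 1

/-- Tests. -/
inductive Test
  | natEq (e f : NExp)
  | natLt (e f : NExp)
  | realLt (e f : RExp)
  | neg (b : Test)
  | and (b c : Test)

/-- Truth of a test. -/
def Test.holds (m : Mem) : Test → Prop
  | .natEq e f => e.eval m = f.eval m
  | .natLt e f => e.eval m < f.eval m
  | .realLt e f => e.eval m < f.eval m
  | .neg b => ¬ b.holds m
  | .and b c => b.holds m ∧ c.holds m

/-- Cost of a test. -/
def Test.cost : Test → ℕ
  | .natEq e f => e.cost + f.cost + 1
  | .natLt e f => e.cost + f.cost + 1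
  | .realLt e f => e.cost + f.cost + 1
  | .neg b => b.cost + 1
  | .and b c => b.cost + c.cost + 1

/-- Programs. `loop v e c` evaluates `e` once and then runs `c` with register `v` set to
`0, 1, …, e - 1` in turn. -/
inductive Prog
  | skip
  | setReg (v : ℕ) (e : NExp)
  | setNat (a : ℕ) (i j e : NExp)
  | setReal (a : ℕ) (i j : NExp) (e : RExp)
  | seq (c d : Prog)
  | ite (b : Test) (c d : Prog)
  | loop (v : ℕ) (e : NExp) (c : Prog)

/-- Apply `f 0`, then `f 1`, …, then `f (N - 1)`. -/
def iterate (f : ℕ → Mem → Mem) : ℕ → Mem → Mem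
  | 0, m => m
  | N + 1, m => f N (iterate f N m)

open Classical in
/-- The memory after the execution of a program. -/
noncomputable def Prog.exec : Prog → Mem → Mem
  | .skip, m => m
  | .setReg v e, m => m.setReg v (e.eval m)
  | .setNat a i j e, m => m.setNat a (i.eval m) (j.eval m) (e.eval m)
  | .setReal a i j e, m => m.setReal a (i.eval m) (j.eval m) (e.eval m)
  | .seq c d, m => d.exec (c.exec m)
  | .ite b c d, m => if b.holds m then c.exec m else d.exec m
  | .loop v e c, m => iterate (fun k m' => c.exec (m'.setReg v k)) (e.eval m) m

open Classical in
/-- The number of steps of the execution of a program. -/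
noncomputable def Prog.cost : Prog → Mem → ℕ
  | .skip, _ => 1
  | .setReg _ e, _ => e.cost + 1
  | .setNat _ i j e, _ => i.cost + j.cost + e.cost + 1
  | .setReal _ i j e, _ => i.cost + j.cost + e.cost + 1
  | .seq c d, m => c.cost m + d.cost (c.exec m)
  | .ite b c d, m => b.cost + (if b.holds m then c.cost m else d.cost m) + 1
  | .loop v e c, m => e.cost + 1 + ∑ k ∈ Finset.range (e.eval m),
      (c.cost ((iterate (fun k' m' => c.exec (m'.setReg v k')) k m).setReg v k) + 1)

/-! ### Input and output of an implementation of the algorithm -/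

/-- A vector as the first column of a real array, with zeros elsewhere. -/
noncomputable def vecArray {n : ℕ} (v : Fin n → ℝ) : ℕ → ℕ → ℝ := fun i j =>
  if h : i < n ∧ j = 0 then v ⟨i, h.1⟩ else 0

/-- A matrix as a real array, with zeros elsewhere. -/
noncomputable def matArray {n : ℕ} (M : Matrix (Fin n) (Fin n) ℝ) : ℕ → ℕ → ℝ := fun i j =>
  if h : i < n ∧ j < n then M ⟨i, h.1⟩ ⟨j, h.2⟩ else 0

open Classical in
/-- The memory at the start: register `0` holds `n`, the real arrays `0`, `1`, `2`, `3` hold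
`M`, `q`, `d` and the finite entries of `u`, and the natural-number array `0` marks by `1` the
indices `i` with `u i < ∞`. Everything else is `0`. -/
noncomputable def inputMem {n : ℕ} (M : Matrix (Fin n) (Fin n) ℝ) (q d : Fin n → ℝ)
    (u : Fin n → EReal) : Mem where
  reg := fun v => if v = 0 then n else 0
  nat := fun a i j => if h : a = 0 ∧ i < n ∧ j = 0 then
    (if u ⟨i, h.2.1⟩ < ⊤ then 1 else 0) else 0
  real := fun a => match a with
    | 0 => matArray M
    | 1 => vecArray q
    | 2 => vecArray d
    | 3 => vecArray fun i => (u i).toReal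
    | _ => fun _ _ => 0

/-- Numbers that stand for the three positions. -/
def Pos.code : Pos → ℕ
  | .lower => 0
  | .basic => 1
  | .upper => 2

/-- The memory `m` at the end documents a complete run of the algorithm: register `1` holds the
number `N` of pivots, row `k ≤ N` of the natural-number array `1` holds the index triple after
`k` pivots, and either register `2` holds `0`, the run ends with a solution and real array `4`
holds this solution, or register `2` holds `1` and the run ends with the report that there is
no finite optimal solution. -/
def Documents {n : ℕ} (M : Matrix (Fin n) (Fin n) ℝ) (q p : Fin n → ℝ) (u : Fin n → EReal)
    (m : Mem) : Prop :=
  ∃ σ : ℕ → Status n, IsRun M q p u (m.reg 1) σ ∧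
    (∀ k ≤ m.reg 1, ∀ i : Fin n, m.nat 1 k i = (σ k i).code) ∧
    ((m.reg 2 = 0 ∧ StopsOptimal M q p u (σ (m.reg 1)) ∧
        ∀ i : Fin n, m.real 4 i 0 = solution M q u (σ (m.reg 1)) i) ∨
      (m.reg 2 = 1 ∧ StopsUnbounded M q p u (σ (m.reg 1))))

end PPPA

/-!
Let `M` be symmetric with `M̄ d ≥ 0` for some `d > 0`. Then `M` is positive semidefinite by
completion of squares, and `M d ≥ M̄ d ≥ 0`. If `M_αα` is nonsingular and `v` is the vector that
agrees with `d` off `α` and satisfies `(M v)_α = 0`, then `|v| ≤ d` by a maximum principle, and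
therefore `p̄ ≥ 0` off `α`, where `p̄` is `M v`, and on `α`, where `p̄` is `d - v`.

Hence the basic solution of the problem with `q + τ p` in place of `q` moves monotonically as `τ`
decreases: an index that has left the lower bound never returns to it, and one that has reached
its upper bound stays there. A lower index with `p̄_i > 0` has a positive Schur complement entry,
since the kernel of a positive semidefinite matrix is orthogonal to `p = M d`. So every pivot is
diagonal and moves one index one step along `β → α → γ`, which bounds their number by `2 n`. The
optimality conditions for `q + τ p` are preserved along the way, and at `τ = 0` they are the
conditions for the given problem.

A diagonal pivot costs `O(n²)` operations on a tableau that expresses the dependent variables by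
the independent ones, and hence `O(n³)` altogether.
-/

namespace PPPA

open Matrix

variable {n : ℕ} {M : Matrix (Fin n) (Fin n) ℝ} {d q p x y h : Fin n → ℝ} {u : Fin n → EReal}
  {s s' : Status n} {i j : Fin n} {t t' : ℝ} {A : ℕ → ℕ → ℝ} {σ : ℕ → Status n}

/-! ### Generalized diagonal dominance -/

theorem dotProduct_mulVec_comm_of_isSymm {ι R : Type*} [Fintype ι] [CommSemiring R]
    {A : Matrix ι ι R} (hA : A.IsSymm) (x y : ι → R) : x ⬝ᵥ (A *ᵥ y) = y ⬝ᵥ (A *ᵥ x) := by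
  rw [dotProduct_mulVec, ← mulVec_transpose, hA.eq, dotProduct_comm]

theorem comparison_apply_self (M : Matrix (Fin n) (Fin n) ℝ) (i : Fin n) :
    comparison M i i = M i i := by
  simp [comparison]

theorem comparison_apply_of_ne (M : Matrix (Fin n) (Fin n) ℝ) (hij : i ≠ j) :
    comparison M i j = -|M i j| := by
  simp [comparison, hij]

theorem comparison_mulVec_le (M : Matrix (Fin n) (Fin n) ℝ) (hy : ∀ j, |y j| ≤ h j)
    (hi : y i = h i) : (comparison M *ᵥ h) i ≤ (M *ᵥ y) i := by
  simp only [mulVec, dotProduct]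
  refine Finset.sum_le_sum fun j _ => ?_
  obtain rfl | hij := eq_or_ne i j
  · rw [comparison_apply_self, hi]
  · rw [comparison_apply_of_ne M hij]
    calc -|M i j| * h j ≤ -(|M i j| * |y j|) := by
          rw [neg_mul]
          exact neg_le_neg (mul_le_mul_of_nonneg_left (hy j) (abs_nonneg _))
      _ ≤ M i j * y j := abs_mul (M i j) (y j) ▸ neg_abs_le _

theorem comparison_mulVec_abs_le (M : Matrix (Fin n) (Fin n) ℝ) (y : Fin n → ℝ) (i : Fin n) :
    (comparison M *ᵥ fun j => |y j|) i ≤ |(M *ᵥ y) i| := by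
  rcases le_total 0 (y i) with hi | hi
  · exact (comparison_mulVec_le M (fun _ => le_rfl) (abs_of_nonneg hi).symm).trans (le_abs_self _)
  · have hneg : (comparison M *ᵥ fun j => |y j|) i ≤ (M *ᵥ (-y)) i :=
      comparison_mulVec_le M (fun j => by simp) (by simp [abs_of_nonpos hi])
    rw [mulVec_neg] at hneg
    exact hneg.trans (neg_le_abs _)

/-- The matrix `M` is symmetric and generalized diagonally dominant with the scaling `d`:
`m_ii d_i ≥ ∑_{j ≠ i} |m_ij| d_j` in every row. -/
structure DiagDominant (M : Matrix (Fin n) (Fin n) ℝ) (d : Fin n → ℝ) : Prop where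
  symm : M.IsSymm
  pos : ∀ i, 0 < d i
  comparison_nonneg : ∀ i, 0 ≤ (comparison M *ᵥ d) i

theorem two_mul_abs_mul_abs_le (a b : ℝ) {r s : ℝ} (hr : 0 < r) (hs : 0 < s) :
    2 * (|a| * |b|) ≤ s * (a ^ 2 / r) + r * (b ^ 2 / s) := by
  have hsq : s * (a ^ 2 / r) + r * (b ^ 2 / s) - 2 * (|a| * |b|) =
      r * s * (|a| / r - |b| / s) ^ 2 := by
    rw [← sq_abs a, ← sq_abs b]
    field_simp
    ring
  exact sub_nonneg.1 (hsq ▸ mul_nonneg (mul_pos hr hs).le (sq_nonneg _))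

theorem DiagDominant.quadratic_nonneg (hM : DiagDominant M d) (x : Fin n → ℝ) :
    0 ≤ x ⬝ᵥ (M *ᵥ x) := by
  let a : Fin n → Fin n → ℝ := fun i j => comparison M i j * d j * (x i ^ 2 / d i)
  have ha : 0 ≤ ∑ i, ∑ j, a i j := Finset.sum_nonneg fun i _ => by
    simp only [a, ← Finset.sum_mul]
    exact mul_nonneg (hM.comparison_nonneg i) (div_nonneg (sq_nonneg _) (hM.pos i).le)
  have hle : ∀ i j, (a i j + a j i) / 2 ≤ x i * (M i j * x j) := by
    intro i j
    obtain rfl | hij := eq_or_ne i j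
    · have := (hM.pos i).ne'
      refine le_of_eq ?_
      simp only [a, comparison_apply_self]
      field_simp
      ring
    · have habs : -(|M i j| * (|x i| * |x j|)) ≤ x i * (M i j * x j) := by
        have := neg_abs_le (x i * (M i j * x j))
        rw [abs_mul, abs_mul] at this
        linarith
      have hmul := mul_le_mul_of_nonneg_left
        (two_mul_abs_mul_abs_le (x i) (x j) (hM.pos i) (hM.pos j)) (abs_nonneg (M i j))
      simp only [a, comparison_apply_of_ne M hij, comparison_apply_of_ne M hij.symm,
        hM.symm.apply i j]
      linarith
  calc 0 ≤ ∑ i, ∑ j, a i j := ha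
    _ = ∑ i, ∑ j, (a i j + a j i) / 2 := by
      simp only [add_div, Finset.sum_add_distrib]
      rw [Finset.sum_comm (f := fun i j => a j i / 2), ← Finset.sum_add_distrib]
      simp only [← Finset.sum_add_distrib, add_halves]
    _ ≤ ∑ i, ∑ j, x i * (M i j * x j) :=
      Finset.sum_le_sum fun i _ => Finset.sum_le_sum fun j _ => hle i j
    _ = x ⬝ᵥ (M *ᵥ x) := by
      simp only [dotProduct, mulVec, Finset.mul_sum]

theorem DiagDominant.posSemidef (hM : DiagDominant M d) : M.PosSemidef :=
  .of_dotProduct_mulVec_nonneg (by simpa [IsHermitian, IsSymm] using hM.symm)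
    fun x => by simpa using hM.quadratic_nonneg x

theorem abs_eq_of_mulVec_eq_zero (hy : ∀ j, |y j| ≤ h j) (hi : |y i| = h i)
    (hMy : (M *ᵥ y) i = 0) (hMh : 0 ≤ (comparison M *ᵥ h) i) (hij : M i j ≠ 0) :
    |y j| = h j := by
  have hterm : ∀ k ∈ Finset.univ, comparison M i k * (h k - |y k|) ≤ 0 := by
    intro k _
    obtain rfl | hik := eq_or_ne i k
    · simp [hi]
    · rw [comparison_apply_of_ne M hik]
      exact mul_nonpos_of_nonpos_of_nonneg (neg_nonpos.2 (abs_nonneg _)) (sub_nonneg.2 (hy k))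
  have hsum : 0 ≤ ∑ k, comparison M i k * (h k - |y k|) := by
    have hCy := comparison_mulVec_abs_le M y i
    rw [hMy, abs_zero] at hCy
    simpa only [mul_sub, Finset.sum_sub_distrib, mulVec, dotProduct] using
      sub_nonneg.2 (hCy.trans hMh)
  have hzero := (Finset.sum_eq_zero_iff_of_nonpos hterm).1
    ((Finset.sum_nonpos hterm).antisymm hsum) j (Finset.mem_univ j)
  obtain rfl | hne := eq_or_ne i j
  · exact hi
  · rw [comparison_apply_of_ne M hne, mul_eq_zero, neg_eq_zero, abs_eq_zero] at hzero
    linarith [hzero.resolve_left hij]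

/-! ### Linear systems with the basic block -/

/-- Unique solvability of the systems with the matrix `M_αα`. -/
abbrev Regular (M : Matrix (Fin n) (Fin n) ℝ) (s : Status n) : Prop :=
  IsUnit (basicBlock M s).det

theorem mulVec_eq_sum_basic (M : Matrix (Fin n) (Fin n) ℝ) {x : Fin n → ℝ}
    (hx : ∀ i, s i ≠ Pos.basic → x i = 0) (i : Fin n) :
    (M *ᵥ x) i = ∑ j : {i : Fin n // s i = Pos.basic}, M i j * x j := by
  rw [← Finset.sum_subtype (Finset.univ.filter fun i => s i = Pos.basic) (by simp)
    fun j => M i j * x j]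
  symm
  apply Finset.sum_filter_of_ne
  intro j _ hj
  by_contra hsj
  exact hj (by rw [hx j hsj, mul_zero])

theorem regular_iff : Regular M s ↔ ∀ x : Fin n → ℝ, (∀ i, s i ≠ Pos.basic → x i = 0) →
      (∀ i, s i = Pos.basic → (M *ᵥ x) i = 0) → x = 0 := by
  rw [Regular, isUnit_iff_ne_zero, Ne, ← exists_mulVec_eq_zero_iff]
  push Not
  constructor
  · intro hker x hx hMx
    by_contra hne
    refine hker (fun j => x j) (fun hzero => hne ?_) ?_
    · funext i
      by_cases hi : s i = Pos.basic
      · exact congrFun hzero ⟨i, hi⟩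
      · exact hx i hi
    · funext i
      rw [Pi.zero_apply, ← hMx i i.2, mulVec_eq_sum_basic M hx]
      rfl
  · intro hker v hv hMv
    refine hv ?_
    have hx : ∀ i, s i ≠ Pos.basic →
        (fun i => if h : s i = Pos.basic then v ⟨i, h⟩ else 0) i = 0 := fun i hi => by simp [hi]
    have hzero := hker _ hx fun i hi => by
      rw [mulVec_eq_sum_basic M hx, ← Pi.zero_apply (M := fun _ => ℝ) (⟨i, hi⟩ : {i // s i = _}),
        ← hMv]
      exact Finset.sum_congr rfl fun j _ => by simp [basicBlock, j.2]
    funext i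
    simpa [i.2] using congrFun hzero i

theorem regular_initial (M : Matrix (Fin n) (Fin n) ℝ) : Regular M (initial n) :=
  regular_iff.2 fun x hx _ => funext fun i => hx i (by simp [initial])

theorem basicSolve_of_ne {v : Fin n → ℝ} (hi : s i ≠ Pos.basic) : basicSolve M s v i = 0 := by
  simp [basicSolve, hi]

theorem mulVec_basicSolve (hs : Regular M s) (v : Fin n → ℝ) (hi : s i = Pos.basic) :
    (M *ᵥ basicSolve M s v) i = v i := by
  have hinv : basicBlock M s *ᵥ ((basicBlock M s)⁻¹ *ᵥ fun j => v j.val) = fun j => v j.val := by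
    rw [mulVec_mulVec, mul_nonsing_inv _ hs, one_mulVec]
  rw [mulVec_eq_sum_basic M fun i hi => basicSolve_of_ne hi]
  refine Eq.trans ?_ (congrFun hinv ⟨i, hi⟩)
  exact Finset.sum_congr rfl fun j _ => by simp [basicSolve, basicBlock, j.2]

theorem bar_of_basic {v : Fin n → ℝ} (hi : s i = Pos.basic) :
    bar M s v i = basicSolve M s v i := by
  simp [bar, hi]

theorem bar_of_ne {v : Fin n → ℝ} (hi : s i ≠ Pos.basic) :
    bar M s v i = v i - (M *ᵥ basicSolve M s v) i := by
  simp [bar, hi, mulVec, dotProduct]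

theorem mhat_of_ne (hj : s j ≠ Pos.basic) : mhat M s i j = 0 :=
  basicSolve_of_ne hj

theorem schurDiag_eq (M : Matrix (Fin n) (Fin n) ℝ) (s : Status n) (i : Fin n) :
    schurDiag M s i = (M *ᵥ (Pi.single i 1 - mhat M s i)) i := by
  rw [mulVec_sub, Pi.sub_apply, mulVec_single_one]
  rfl

theorem mulVec_single_sub_mhat (hs : Regular M s) (hj : s j = Pos.basic) :
    (M *ᵥ (Pi.single i 1 - mhat M s i)) j = 0 := by
  rw [mulVec_sub, Pi.sub_apply, mhat, mulVec_basicSolve hs _ hj, mulVec_single_one, col_apply,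
    sub_self]

theorem single_sub_mhat_dotProduct (hi : s i ≠ Pos.basic) {w : Fin n → ℝ}
    (hw : ∀ j, s j = Pos.basic → w j = 0) : (Pi.single i 1 - mhat M s i) ⬝ᵥ w = w i := by
  rw [dotProduct, Finset.sum_eq_single i]
  · simp [mhat_of_ne hi]
  · intro j _ hji
    by_cases hj : s j = Pos.basic
    · rw [hw j hj, mul_zero]
    · simp [mhat_of_ne hj, hji]
  · simp

theorem Regular.mono (hM : M.PosSemidef) (hs : Regular M s)
    (hss : ∀ i, s' i = Pos.basic → s i = Pos.basic) : Regular M s' := by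
  refine regular_iff.2 fun x hx hMx => ?_
  have hquad : x ⬝ᵥ (M *ᵥ x) = 0 := Finset.sum_eq_zero fun i _ => by
    by_cases hi : s' i = Pos.basic
    · rw [hMx i hi, mul_zero]
    · rw [hx i hi, zero_mul]
  have hker : M *ᵥ x = 0 := (hM.dotProduct_mulVec_zero_iff x).1 (by simpa using hquad)
  exact regular_iff.1 hs x (fun i hi => hx i (mt (hss i) hi)) fun i _ => congrFun hker i

theorem Regular.update_basic (hs : Regular M s) (hi : s i ≠ Pos.basic)
    (hσ : schurDiag M s i ≠ 0) : Regular M (Function.update s i Pos.basic) := by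
  refine regular_iff.2 fun x hx hMx => ?_
  have hne : ∀ j, s j = Pos.basic → j ≠ i := fun j hj hji => hi (hji ▸ hj)
  have hxz : x = x i • (Pi.single i 1 - mhat M s i) := by
    refine sub_eq_zero.1 (regular_iff.1 hs _ (fun j hj => ?_) (fun j hj => ?_))
    · obtain rfl | hji := eq_or_ne j i
      · simp [mhat_of_ne hj]
      · simp [mhat_of_ne hj, hx j (by rwa [Function.update_of_ne hji]), hji]
    · rw [mulVec_sub, mulVec_smul, Pi.sub_apply, Pi.smul_apply, mulVec_single_sub_mhat hs hj,
        hMx j (by rwa [Function.update_of_ne (hne j hj)]), smul_zero, sub_zero]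
  have hxi : x i * schurDiag M s i = 0 := by
    rw [schurDiag_eq, ← smul_eq_mul, ← Pi.smul_apply, ← mulVec_smul, ← hxz]
    exact hMx i (Function.update_self ..)
  rw [hxz, (mul_eq_zero.1 hxi).resolve_right hσ, zero_smul]

theorem schurDiag_pos (hM : M.PosSemidef) (hs : Regular M s) (hi : s i ≠ Pos.basic)
    (hp : bar M s (M *ᵥ d) i ≠ 0) : 0 < schurDiag M s i := by
  have hsymm : M.IsSymm := by simpa [IsHermitian, IsSymm] using hM.isHermitian
  set z : Fin n → ℝ := Pi.single i 1 - mhat M s i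
  have hzz : z ⬝ᵥ (M *ᵥ z) = schurDiag M s i := by
    rw [schurDiag_eq, single_sub_mhat_dotProduct hi fun j hj => mulVec_single_sub_mhat hs hj]
  have hnonneg : 0 ≤ schurDiag M s i := by
    simpa [hzz] using hM.dotProduct_mulVec_nonneg z
  refine hnonneg.lt_of_ne fun hσ => hp ?_
  have hMz : M *ᵥ z = 0 := (hM.dotProduct_mulVec_zero_iff z).1 (by simp [hzz, ← hσ])
  calc bar M s (M *ᵥ d) i = (M *ᵥ d - M *ᵥ basicSolve M s (M *ᵥ d)) i := bar_of_ne hi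
    _ = z ⬝ᵥ (M *ᵥ d - M *ᵥ basicSolve M s (M *ᵥ d)) :=
      (single_sub_mhat_dotProduct hi fun j hj => by simp [mulVec_basicSolve hs _ hj]).symm
    _ = 0 := by
      rw [← mulVec_sub, dotProduct_mulVec_comm_of_isSymm hsymm, hMz, dotProduct_zero]

theorem mulVec_indicator_eq_zero {ι R : Type*} [Fintype ι] [NonUnitalNonAssocSemiring R]
    {A : Matrix ι ι R} (hA : A.IsSymm) {S : Set ι} {y : ι → R}
    (hS : ∀ i ∈ S, ∀ j, A i j ≠ 0 → j ∈ S) (hy : ∀ i ∈ S, (A *ᵥ y) i = 0) :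
    A *ᵥ S.indicator y = 0 := by
  funext i
  by_cases hi : i ∈ S
  · rw [Pi.zero_apply, ← hy i hi]
    refine Finset.sum_congr rfl fun j _ => ?_
    by_cases hij : A i j = 0
    · simp only [hij, zero_mul]
    · rw [Set.indicator_of_mem (hS i hi j hij)]
  · simp only [mulVec, dotProduct, Pi.zero_apply]
    refine Finset.sum_eq_zero fun j _ => ?_
    by_cases hj : j ∈ S
    · rw [← hA.apply, not_not.1 (mt (hS j hj i) hi), zero_mul]
    · rw [Set.indicator_of_notMem hj, mul_zero]

/-- If the largest ratio `μ = |y_i| / d_i` exceeded `1`, the part of `y` where it is attained would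
be a nonzero basic vector in the kernel of `M`. -/
theorem DiagDominant.abs_le_of_mulVec_eq_zero (hM : DiagDominant M d) (hs : Regular M s)
    (hy : ∀ i, s i = Pos.basic → (M *ᵥ y) i = 0) (hoff : ∀ i, s i ≠ Pos.basic → |y i| ≤ d i)
    (i : Fin n) : |y i| ≤ d i := by
  by_contra! hi
  have : Nonempty (Fin n) := ⟨i⟩
  obtain ⟨k, hk⟩ := Finite.exists_max fun j => |y j| / d j
  set μ := |y k| / d k with hμ
  have hμ_one : 1 < μ := ((one_lt_div (hM.pos i)).2 hi).trans_le (hk i)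
  have hyμ : ∀ j, |y j| ≤ (μ • d) j := fun j => (div_le_iff₀ (hM.pos j)).1 (hk j)
  let S : Set (Fin n) := {j | |y j| = μ * d j}
  have hkS : k ∈ S := (div_mul_cancel₀ _ (hM.pos k).ne').symm
  have hbasic : ∀ j ∈ S, s j = Pos.basic := fun j (hj : |y j| = μ * d j) => by
    by_contra hsj
    nlinarith [hoff j hsj, hM.pos j]
  have hrow : ∀ j ∈ S, ∀ l, M j l ≠ 0 → l ∈ S := fun j hj l hjl =>
    abs_eq_of_mulVec_eq_zero hyμ hj (hy j (hbasic j hj))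
      (by rw [mulVec_smul]
          exact mul_nonneg (one_pos.trans hμ_one).le (hM.comparison_nonneg j)) hjl
  have hker : M *ᵥ S.indicator y = 0 :=
    mulVec_indicator_eq_zero hM.symm hrow fun j hj => hy j (hbasic j hj)
  have hzero : S.indicator y = 0 := regular_iff.1 hs _
    (fun j hj => Set.indicator_of_notMem (mt (hbasic j) hj) y) fun j _ => congrFun hker j
  have hyk : y k = 0 := by
    rw [← Set.indicator_of_mem hkS y, hzero, Pi.zero_apply]
  rw [hμ, hyk, abs_zero, zero_div] at hμ_one
  exact absurd hμ_one (by norm_num)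

theorem DiagDominant.bar_nonneg (hM : DiagDominant M d) (hs : Regular M s) (i : Fin n) :
    0 ≤ bar M s (M *ᵥ d) i := by
  set y := d - basicSolve M s (M *ᵥ d) with hyd
  have hoff : ∀ j, s j ≠ Pos.basic → y j = d j := fun j hj => by simp [hyd, basicSolve_of_ne hj]
  have hMy : ∀ j, (M *ᵥ y) j = (M *ᵥ d) j - (M *ᵥ basicSolve M s (M *ᵥ d)) j := fun j => by
    rw [hyd, mulVec_sub, Pi.sub_apply]
  have hle : ∀ j, |y j| ≤ d j := hM.abs_le_of_mulVec_eq_zero hs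
    (fun j hj => by rw [hMy, mulVec_basicSolve hs _ hj, sub_self])
    fun j hj => by rw [hoff j hj, abs_of_pos (hM.pos j)]
  by_cases hi : s i = Pos.basic
  · rw [bar_of_basic hi]
    have : d i - basicSolve M s (M *ᵥ d) i ≤ d i := (le_abs_self _).trans (hle i)
    linarith
  · rw [bar_of_ne hi, ← hMy]
    exact (hM.comparison_nonneg i).trans (comparison_mulVec_le M hle (hoff i hi))

/-! ### Optimality conditions along the parametric path -/

/-- The vector with `γ`-part `u_γ` and with zeros elsewhere. -/
noncomputable def upperPart (u : Fin n → EReal) (s : Status n) : Fin n → ℝ := fun i =>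
  if s i = Pos.upper then (u i).toReal else 0

theorem qbar_eq (M : Matrix (Fin n) (Fin n) ℝ) (q : Fin n → ℝ) (u : Fin n → EReal)
    (s : Status n) : qbar M q u s = bar M s (q + M *ᵥ upperPart u s) := by
  unfold qbar
  congr 1
  funext i
  simp [upperPart, mulVec, dotProduct]

theorem basicSolve_add_smul (M : Matrix (Fin n) (Fin n) ℝ) (s : Status n) (v w : Fin n → ℝ)
    (t : ℝ) : basicSolve M s (v + t • w) = basicSolve M s v + t • basicSolve M s w := by
  funext i
  by_cases hi : s i = Pos.basic
  · have hlin : (basicBlock M s)⁻¹ *ᵥ (fun j => (v + t • w) j.val) =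
        (basicBlock M s)⁻¹ *ᵥ (fun j => v j.val) + t • (basicBlock M s)⁻¹ *ᵥ fun j => w j.val := by
      rw [← mulVec_smul, ← mulVec_add]
      rfl
    simpa [basicSolve, hi] using congrFun hlin ⟨i, hi⟩
  · simp [basicSolve, hi]

theorem bar_add_smul (M : Matrix (Fin n) (Fin n) ℝ) (s : Status n) (v w : Fin n → ℝ) (t : ℝ) :
    bar M s (v + t • w) = bar M s v + t • bar M s w := by
  funext i
  by_cases hi : s i = Pos.basic
  · simp [bar_of_basic hi, basicSolve_add_smul]
  · simp only [Pi.add_apply, Pi.smul_apply, smul_eq_mul, bar_of_ne hi, basicSolve_add_smul,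
      mulVec_add, mulVec_smul]
    ring

theorem qbar_add_smul (M : Matrix (Fin n) (Fin n) ℝ) (q p : Fin n → ℝ) (u : Fin n → EReal)
    (s : Status n) (t : ℝ) (i : Fin n) :
    qbar M (q + t • p) u s i = qbar M q u s i + t * bar M s p i := by
  rw [qbar_eq, add_right_comm, bar_add_smul, ← qbar_eq, Pi.add_apply, Pi.smul_apply, smul_eq_mul]

theorem solution_of_lower (hi : s i = Pos.lower) : solution M q u s i = 0 := by
  simp [solution, hi]

theorem solution_of_basic (hi : s i = Pos.basic) : solution M q u s i = -qbar M q u s i := by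
  simp [solution, hi]

theorem solution_of_upper (hi : s i = Pos.upper) : solution M q u s i = (u i).toReal := by
  simp [solution, hi]

theorem solution_eq (M : Matrix (Fin n) (Fin n) ℝ) (q : Fin n → ℝ) (u : Fin n → EReal)
    (s : Status n) :
    solution M q u s = upperPart u s - basicSolve M s (q + M *ᵥ upperPart u s) := by
  funext i
  cases hi : s i
  · simp [solution_of_lower hi, upperPart, hi, basicSolve_of_ne]
  · simp [solution_of_basic hi, upperPart, hi, qbar_eq, bar_of_basic]
  · simp [solution_of_upper hi, upperPart, hi, basicSolve_of_ne]

theorem gradient_solution_of_basic (hs : Regular M s) (hi : s i = Pos.basic) :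
    q i + (M *ᵥ solution M q u s) i = 0 := by
  rw [solution_eq, mulVec_sub, Pi.sub_apply, mulVec_basicSolve hs _ hi, Pi.add_apply]
  ring

theorem gradient_solution_of_ne (hi : s i ≠ Pos.basic) :
    q i + (M *ᵥ solution M q u s) i = qbar M q u s i := by
  rw [solution_eq, mulVec_sub, Pi.sub_apply, qbar_eq, bar_of_ne hi, Pi.add_apply, add_sub_assoc]

/-- The optimality (Karush–Kuhn–Tucker) conditions of the quadratic program at `x`, where the
index triple `s` tells which constraints are treated as active. -/
structure IsKKT (M : Matrix (Fin n) (Fin n) ℝ) (q : Fin n → ℝ) (u : Fin n → EReal)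
    (s : Status n) (x : Fin n → ℝ) : Prop where
  eq_zero : ∀ i, s i = Pos.lower → x i = 0
  eq_upper : ∀ i, s i = Pos.upper → u i < ⊤ ∧ x i = (u i).toReal
  gradient_eq : ∀ i, s i = Pos.basic → q i + (M *ᵥ x) i = 0
  gradient_nonneg : ∀ i, s i = Pos.lower → 0 ≤ q i + (M *ᵥ x) i
  gradient_nonpos : ∀ i, s i = Pos.upper → q i + (M *ᵥ x) i ≤ 0
  mem_box : x ∈ box u

theorem IsKKT.eq_solution (hs : Regular M s) (hx : IsKKT M q u s x) : x = solution M q u s := by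
  refine sub_eq_zero.1 (regular_iff.1 hs _ (fun i hi => ?_) (fun i hi => ?_))
  · cases hsi : s i
    · simp [hx.eq_zero i hsi, solution_of_lower hsi]
    · exact absurd hsi hi
    · simp [(hx.eq_upper i hsi).2, solution_of_upper hsi]
  · rw [mulVec_sub, Pi.sub_apply, sub_eq_zero]
    exact add_left_cancel ((hx.gradient_eq i hi).trans (gradient_solution_of_basic hs hi).symm)

theorem coe_le_iff_le_toReal {a : ℝ} {b : EReal} (hb : 0 < b) :
    (a : EReal) ≤ b ↔ b < ⊤ → a ≤ b.toReal := by
  induction b with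
  | bot => simp at hb
  | coe b => simp
  | top => simp

theorem isKKT_solution_iff (hs : Regular M s) (hu : ∀ i, 0 < u i) :
    IsKKT M q u s (solution M q u s) ↔
      (∀ i, s i = Pos.lower → 0 ≤ qbar M q u s i) ∧
      (∀ i, s i = Pos.basic → qbar M q u s i ≤ 0 ∧ (u i < ⊤ → -qbar M q u s i ≤ (u i).toReal)) ∧
      ∀ i, s i = Pos.upper → u i < ⊤ ∧ qbar M q u s i ≤ 0 := by
  have hne : ∀ i, s i ≠ Pos.basic → q i + (M *ᵥ solution M q u s) i = qbar M q u s i :=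
    fun i hi => gradient_solution_of_ne hi
  constructor
  · intro hx
    refine ⟨fun i hi => hne i (by simp [hi]) ▸ hx.gradient_nonneg i hi, fun i hi => ?_,
      fun i hi => ⟨(hx.eq_upper i hi).1, hne i (by simp [hi]) ▸ hx.gradient_nonpos i hi⟩⟩
    have hbox := hx.mem_box i
    rwa [solution_of_basic hi, neg_nonneg, coe_le_iff_le_toReal (hu i)] at hbox
  · rintro ⟨hlower, hbasic, hupper⟩
    refine ⟨fun i hi => solution_of_lower hi,
      fun i hi => ⟨(hupper i hi).1, solution_of_upper hi⟩,
      fun i hi => gradient_solution_of_basic hs hi,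
      fun i hi => hne i (by simp [hi]) ▸ hlower i hi,
      fun i hi => hne i (by simp [hi]) ▸ (hupper i hi).2, fun i => ?_⟩
    rw [coe_le_iff_le_toReal (hu i)]
    cases hi : s i
    · rw [solution_of_lower hi]
      exact ⟨le_rfl, fun _ => EReal.toReal_nonneg (hu i).le⟩
    · rw [solution_of_basic hi, neg_nonneg]
      exact hbasic i hi
    · rw [solution_of_upper hi]
      exact ⟨EReal.toReal_nonneg (hu i).le, fun _ => le_rfl⟩

/-- With a vanishing partial derivative the index may be declared basic, and at the upper bound it
may be declared nonbasic. -/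
theorem IsKKT.update (hx : IsKKT M q u s x) {v : Pos} (hlower : v ≠ Pos.lower)
    (hgrad : q i + (M *ᵥ x) i = 0) (hupper : v = Pos.upper → u i < ⊤ ∧ x i = (u i).toReal) :
    IsKKT M q u (Function.update s i v) x := by
  have key : ∀ j w, Function.update s i v j = w → s j = w ∨ (j = i ∧ v = w) := by
    intro j w hj
    obtain rfl | hji := eq_or_ne j i
    · exact Or.inr ⟨rfl, by simpa using hj⟩
    · exact Or.inl (by rwa [Function.update_of_ne hji] at hj)
  refine ⟨fun j hj => ?_, fun j hj => ?_, fun j hj => ?_, fun j hj => ?_, fun j hj => ?_,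
    hx.mem_box⟩ <;> rcases key j _ hj with hj | ⟨rfl, hv⟩
  exacts [hx.eq_zero j hj, absurd hv hlower, hx.eq_upper j hj, hupper hv, hx.gradient_eq j hj,
    hgrad, hx.gradient_nonneg j hj, absurd hv hlower, hx.gradient_nonpos j hj, hgrad.le]

theorem objective_sub (hM : M.IsSymm) (x y : Fin n → ℝ) :
    objective M q y - objective M q x =
      (q + M *ᵥ x) ⬝ᵥ (y - x) + 1 / 2 * ((y - x) ⬝ᵥ (M *ᵥ (y - x))) := by
  have hcomm := dotProduct_mulVec_comm_of_isSymm hM x y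
  simp only [objective, mulVec_sub, dotProduct_sub, sub_dotProduct, add_dotProduct,
    dotProduct_comm (M *ᵥ x)]
  linarith

theorem IsKKT.isOptimal (hM : M.PosSemidef) (hx : IsKKT M q u s x) : IsOptimal M q u x := by
  have hsymm : M.IsSymm := by simpa [IsHermitian, IsSymm] using hM.isHermitian
  refine ⟨hx.mem_box, fun y hy => ?_⟩
  have hquad : 0 ≤ (y - x) ⬝ᵥ (M *ᵥ (y - x)) := by
    simpa using hM.dotProduct_mulVec_nonneg (y - x)
  have hlin : 0 ≤ (q + M *ᵥ x) ⬝ᵥ (y - x) := by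
    refine Finset.sum_nonneg fun i _ => ?_
    rw [Pi.add_apply, Pi.sub_apply]
    cases hi : s i
    · rw [hx.eq_zero i hi, sub_zero]
      exact mul_nonneg (hx.gradient_nonneg i hi) (hy i).1
    · rw [hx.gradient_eq i hi, zero_mul]
    · obtain ⟨hui, hxi⟩ := hx.eq_upper i hi
      have hyi := EReal.toReal_le_toReal (hy i).2 (EReal.coe_ne_bot _) hui.ne
      rw [EReal.toReal_coe] at hyi
      exact mul_nonneg_of_nonpos_of_nonpos (hx.gradient_nonpos i hi) (by linarith)
  rw [← sub_nonneg, objective_sub hsymm]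
  linarith

/-! ### Critical values -/

/-- The ratio with which the index `i` competes in the first ratio test, and `0` if it does not
compete. -/
noncomputable def ratio (M : Matrix (Fin n) (Fin n) ℝ) (q p : Fin n → ℝ) (u : Fin n → EReal)
    (s : Status n) (i : Fin n) : ℝ :=
  if s i = Pos.lower ∧ 0 < bar M s p i then -(qbar M q u s i / bar M s p i)
  else if s i = Pos.basic ∧ 0 < bar M s p i ∧ u i < ⊤ then
    -(((u i).toReal + qbar M q u s i) / bar M s p i)
  else 0

theorem LowerRatio.ratio_eq (hi : LowerRatio M q p u s i t) : ratio M q p u s i = t := by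
  rw [ratio, if_pos ⟨hi.1, hi.2.1⟩, hi.2.2]

theorem UpperRatio.ratio_eq (hi : UpperRatio M q p u s i t) : ratio M q p u s i = t := by
  rw [ratio, if_neg (by simp [hi.1]), if_pos ⟨hi.1, hi.2.1, hi.2.2.1⟩, hi.2.2.2]

theorem lowerRatio_or_upperRatio (hi : ratio M q p u s i ≠ 0) :
    LowerRatio M q p u s i (ratio M q p u s i) ∨ UpperRatio M q p u s i (ratio M q p u s i) := by
  unfold ratio at hi ⊢
  split_ifs at hi ⊢ with hlower hbasic
  · exact Or.inl ⟨hlower.1, hlower.2, rfl⟩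
  · exact Or.inr ⟨hbasic.1, hbasic.2.1, hbasic.2.2, rfl⟩
  · exact absurd rfl hi

theorem isCritical_iff :
    IsCritical M q p u s t ↔ IsGreatest (insert 0 (Set.range (ratio M q p u s))) t := by
  rw [IsCritical]
  congr! 1
  ext r
  constructor
  · rintro ((hr | ⟨i, hi⟩) | ⟨i, hi⟩)
    exacts [Or.inl hr, Or.inr ⟨i, hi.ratio_eq⟩, Or.inr ⟨i, hi.ratio_eq⟩]
  · rintro (hr | ⟨i, rfl⟩)
    · exact Or.inl (Or.inl hr)
    · by_cases hi : ratio M q p u s i = 0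
      · exact Or.inl (Or.inl hi)
      · exact (lowerRatio_or_upperRatio hi).imp (fun h => Or.inr ⟨i, h⟩) fun h => ⟨i, h⟩

theorem exists_isCritical (M : Matrix (Fin n) (Fin n) ℝ) (q p : Fin n → ℝ) (u : Fin n → EReal)
    (s : Status n) : ∃ t, IsCritical M q p u s t := by
  obtain ⟨t, ht⟩ := ((Set.finite_range (ratio M q p u s)).insert 0).exists_maximal
    (Set.insert_nonempty _ _)
  exact ⟨t, isCritical_iff.2 ⟨ht.1, fun r hr => (le_total r t).elim id (ht.2 hr)⟩⟩

theorem IsCritical.nonneg (ht : IsCritical M q p u s t) : 0 ≤ t :=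
  ht.2 (Or.inl (Or.inl rfl))

theorem qbar_add_smul_of_lowerRatio (hi : LowerRatio M q p u s i t) :
    qbar M (q + t • p) u s i = 0 := by
  have := hi.2.1.ne'
  rw [qbar_add_smul, hi.2.2]
  field_simp
  ring

theorem qbar_add_smul_of_upperRatio (hi : UpperRatio M q p u s i t) :
    qbar M (q + t • p) u s i = -(u i).toReal := by
  have := hi.2.1.ne'
  rw [qbar_add_smul, hi.2.2.2]
  field_simp
  ring

theorem IsCritical.qbar_nonneg (ht : IsCritical M q p u s t) (hi : s i = Pos.lower)
    (hp : 0 < bar M s p i) : 0 ≤ qbar M (q + t • p) u s i := by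
  have hle := ht.2 (Or.inl (Or.inr ⟨i, hi, hp, rfl⟩))
  rw [← neg_div, div_le_iff₀ hp] at hle
  rw [qbar_add_smul]
  linarith

theorem IsCritical.neg_qbar_le (ht : IsCritical M q p u s t) (hi : s i = Pos.basic)
    (hp : 0 < bar M s p i) (hu : u i < ⊤) : -qbar M (q + t • p) u s i ≤ (u i).toReal := by
  have hle := ht.2 (Or.inr ⟨i, hi, hp, hu, rfl⟩)
  rw [← neg_div, div_le_iff₀ hp] at hle
  rw [qbar_add_smul]
  linarith

theorem IsCritical.le_of_isKKT (ht' : IsCritical M q p u s t') (hs : Regular M s)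
    (hu : ∀ i, 0 < u i) (ht : 0 ≤ t)
    (hx : IsKKT M (q + t • p) u s (solution M (q + t • p) u s)) : t' ≤ t := by
  obtain ⟨hlower, hbasic, -⟩ := (isKKT_solution_iff hs hu).1 hx
  rcases ht'.1 with (rfl | ⟨i, hi, hpi, rfl⟩) | ⟨i, hi, hpi, hui, rfl⟩
  · exact ht
  · have hqi := hlower i hi
    rw [qbar_add_smul] at hqi
    rw [← neg_div, div_le_iff₀ hpi]
    linarith
  · have hqi := (hbasic i hi).2 hui
    rw [qbar_add_smul] at hqi
    rw [← neg_div, div_le_iff₀ hpi]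
    linarith

theorem IsKKT.of_isCritical (hs : Regular M s) (hu : ∀ i, 0 < u i) (hp : ∀ i, 0 ≤ bar M s p i)
    (ht : 0 ≤ t) (hx : IsKKT M (q + t • p) u s x) (ht' : IsCritical M q p u s t') :
    IsKKT M (q + t' • p) u s (solution M (q + t' • p) u s) := by
  obtain rfl := hx.eq_solution hs
  have hle := ht'.le_of_isKKT hs hu ht hx
  obtain ⟨hlower, hbasic, hupper⟩ := (isKKT_solution_iff hs hu).1 hx
  have hmono : ∀ i, qbar M (q + t' • p) u s i ≤ qbar M (q + t • p) u s i := fun i => by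
    rw [qbar_add_smul, qbar_add_smul]
    exact add_le_add_right (mul_le_mul_of_nonneg_right hle (hp i)) _
  have hconst : ∀ i, 0 = bar M s p i → qbar M (q + t' • p) u s i = qbar M (q + t • p) u s i :=
    fun i hi => by rw [qbar_add_smul, qbar_add_smul, ← hi, mul_zero, mul_zero]
  refine (isKKT_solution_iff hs hu).2 ⟨fun i hi => ?_, fun i hi => ⟨?_, fun hui => ?_⟩,
    fun i hi => ⟨(hupper i hi).1, (hmono i).trans (hupper i hi).2⟩⟩
  · rcases (hp i).lt_or_eq with hpi | hpi
    · exact ht'.qbar_nonneg hi hpi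
    · rw [hconst i hpi]
      exact hlower i hi
  · exact (hmono i).trans (hbasic i hi).1
  · rcases (hp i).lt_or_eq with hpi | hpi
    · exact ht'.neg_qbar_le hi hpi hui
    · rw [hconst i hpi]
      exact (hbasic i hi).2 hui

/-! ### Pivots and runs -/

/-- The properties of an index triple that the algorithm maintains. -/
structure Invariant (M : Matrix (Fin n) (Fin n) ℝ) (q p : Fin n → ℝ) (u : Fin n → EReal)
    (s : Status n) : Prop where
  regular : Regular M s
  exists_isKKT : ∃ (t : ℝ) (x : Fin n → ℝ), 0 ≤ t ∧ IsKKT M (q + t • p) u s x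

theorem invariant_initial (hu : ∀ i, 0 < u i) (ht : 0 ≤ t) (hq : ∀ i, 0 ≤ q i + t * p i) :
    Invariant M q p u (initial n) := by
  refine ⟨regular_initial M, t, 0, ht, ?_⟩
  constructor <;> simp [initial, hq, box, fun i => (hu i).le]

theorem Invariant.isKKT_of_isCritical (hs : Invariant M q p u s) (hu : ∀ i, 0 < u i)
    (hp : ∀ i, 0 ≤ bar M s p i) (ht : IsCritical M q p u s t) :
    IsKKT M (q + t • p) u s (solution M (q + t • p) u s) := by
  obtain ⟨t₀, x₀, ht₀, hx₀⟩ := hs.exists_isKKT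
  exact hx₀.of_isCritical hs.regular hu hp ht₀ ht

theorem Invariant.isOptimal (hM : M.PosSemidef) (hs : Invariant M q p u s) (hu : ∀ i, 0 < u i)
    (hp : ∀ i, 0 ≤ bar M s p i) (hstopped : StopsOptimal M q p u s) :
    IsOptimal M q u (solution M q u s) := by
  have hx := hs.isKKT_of_isCritical hu hp hstopped
  rw [zero_smul, add_zero] at hx
  exact hx.isOptimal hM

theorem schurDiag_pos_of_lowerRatio (hM : M.PosSemidef) (hs : Regular M s)
    (hi : LowerRatio M q (M *ᵥ d) u s i t) : 0 < schurDiag M s i :=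
  schurDiag_pos hM hs (by simp [hi.1]) hi.2.1.ne'

theorem Pivot.kind_eq (hM : M.PosSemidef) (hs : Regular M s) {κ : Kind}
    (hpivot : Pivot M q (M *ᵥ d) u κ s s') : κ = Kind.toUpper ∨ κ = Kind.enter := by
  cases hpivot with
  | toUpper => exact Or.inl rfl
  | enter => exact Or.inr rfl
  | jump _ _ _ _ _ hi hσ => exact absurd hσ (schurDiag_pos_of_lowerRatio hM hs hi).ne'
  | swapDown _ _ _ _ _ _ _ hi hσ => exact absurd hσ (schurDiag_pos_of_lowerRatio hM hs hi).ne'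
  | swapUp _ _ _ _ _ _ _ hi hσ => exact absurd hσ (schurDiag_pos_of_lowerRatio hM hs hi).ne'

theorem not_stopsUnbounded (hM : M.PosSemidef) (hs : Regular M s) :
    ¬ StopsUnbounded M q (M *ᵥ d) u s := by
  rintro ⟨t, i, -, -, hi, hσ, -⟩
  exact absurd hσ (schurDiag_pos_of_lowerRatio hM hs hi).ne'

theorem Invariant.pivot (hM : M.PosSemidef) (hs : Invariant M q (M *ᵥ d) u s)
    (hu : ∀ i, 0 < u i) (hp : ∀ i, 0 ≤ bar M s (M *ᵥ d) i) {κ : Kind}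
    (hpivot : Pivot M q (M *ᵥ d) u κ s s') : Invariant M q (M *ᵥ d) u s' := by
  have hκ := hpivot.kind_eq hM hs.regular
  cases hpivot with
  | toUpper _ t i hcrit ht hi =>
    have hx := hs.isKKT_of_isCritical hu hp hcrit
    have hxi : solution M (q + t • M *ᵥ d) u s i = (u i).toReal := by
      rw [solution_of_basic hi.1, qbar_add_smul_of_upperRatio hi, neg_neg]
    refine ⟨hs.regular.mono hM fun j hj => ?_, t, _, ht.le,
      hx.update Pos.noConfusion (hx.gradient_eq i hi.1) fun _ => ⟨hi.2.2.1, hxi⟩⟩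
    obtain rfl | hji := eq_or_ne j i
    · exact hi.1
    · rwa [Function.update_of_ne hji] at hj
  | enter _ t i hcrit ht hi hσ =>
    have hne : s i ≠ Pos.basic := by simp [hi.1]
    exact ⟨hs.regular.update_basic hne hσ.ne', t, _, ht.le,
      (hs.isKKT_of_isCritical hu hp hcrit).update Pos.noConfusion
        ((gradient_solution_of_ne hne).trans (qbar_add_smul_of_lowerRatio hi)) Pos.noConfusion⟩
  | _ => simp at hκ

/-- The position to which a diagonal pivot moves an index; no pivot applies to the position
`upper`. -/
def Pos.next : Pos → Pos
  | .lower => .basic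
  | .basic => .upper
  | .upper => .upper

theorem Pos.code_next {v : Pos} (hv : v ≠ .upper) : v.next.code = v.code + 1 := by
  cases v <;> simp_all [next, code]

theorem Pivot.eq_update_next (hM : M.PosSemidef) (hs : Regular M s) {κ : Kind}
    (hpivot : Pivot M q (M *ᵥ d) u κ s s') :
    ∃ i, s i ≠ Pos.upper ∧ s' = Function.update s i (s i).next := by
  have hκ := hpivot.kind_eq hM hs
  cases hpivot with
  | toUpper _ _ i _ _ hi => exact ⟨i, by simp [hi.1], by rw [hi.1, Pos.next]⟩
  | enter _ _ i _ _ hi => exact ⟨i, by simp [hi.1], by rw [hi.1, Pos.next]⟩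
  | _ => simp at hκ

theorem exists_pivot_update_next (hM : M.PosSemidef) (hs : Regular M s) (ht : 0 < t)
    (hcrit : IsCritical M q (M *ᵥ d) u s t) (hi : ratio M q (M *ᵥ d) u s i = t) :
    ∃ κ, Pivot M q (M *ᵥ d) u κ s (Function.update s i (s i).next) := by
  rcases lowerRatio_or_upperRatio (hi.trans_ne ht.ne') with h | h <;> rw [hi] at h <;>
    rw [h.1, Pos.next]
  · exact ⟨_, .enter s t i hcrit ht h (schurDiag_pos_of_lowerRatio hM hs h)⟩
  · exact ⟨_, .toUpper s t i hcrit ht h⟩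

theorem stopsOptimal_or_exists_pivot (hM : M.PosSemidef) (hs : Regular M s) :
    StopsOptimal M q (M *ᵥ d) u s ∨ ∃ κ s', Pivot M q (M *ᵥ d) u κ s s' := by
  obtain ⟨t, hcrit⟩ := exists_isCritical M q (M *ᵥ d) u s
  rcases hcrit.nonneg.eq_or_lt with rfl | ht
  · exact Or.inl hcrit
  · rcases (isCritical_iff.1 hcrit).1 with h0 | ⟨i, hi⟩
    · exact absurd h0 ht.ne'
    · obtain ⟨κ, hκ⟩ := exists_pivot_update_next hM hs ht hcrit hi
      exact Or.inr ⟨κ, _, hκ⟩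

theorem sum_code_update_next (hi : s i ≠ Pos.upper) :
    ∑ j, (Function.update s i (s i).next j).code = ∑ j, (s j).code + 1 := by
  rw [← Finset.add_sum_erase _ _ (Finset.mem_univ i),
    ← Finset.add_sum_erase _ (fun j => (s j).code) (Finset.mem_univ i), Function.update_self,
    Pos.code_next hi,
    Finset.sum_congr rfl fun j hj => by rw [Function.update_of_ne (Finset.ne_of_mem_erase hj)]]
  ring

theorem sum_code_le (s : Status n) : ∑ j, (s j).code ≤ 2 * n := by
  refine (Finset.sum_le_card_nsmul _ _ 2 fun j _ => ?_).trans (by simp [mul_comm])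
  cases s j <;> simp [Pos.code]

theorem IsRun.invariant (hM : DiagDominant M d) (hu : ∀ i, 0 < u i)
    (h0 : Invariant M q (M *ᵥ d) u (initial n)) {N : ℕ} {σ : ℕ → Status n}
    (hrun : IsRun M q (M *ᵥ d) u N σ) :
    ∀ k ≤ N, Invariant M q (M *ᵥ d) u (σ k) ∧ ∑ j, (σ k j).code = k := by
  intro k
  induction k with
  | zero =>
    rw [hrun.1]
    exact fun _ => ⟨h0, by simp [initial, Pos.code]⟩
  | succ k ih =>
    intro hk
    obtain ⟨hinv, hsum⟩ := ih (by omega)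
    obtain ⟨κ, hpivot⟩ := hrun.2 k hk
    obtain ⟨i, hi, hσ⟩ := hpivot.eq_update_next hM.posSemidef hinv.regular
    refine ⟨hinv.pivot hM.posSemidef hu (hM.bar_nonneg hinv.regular) hpivot, ?_⟩
    rw [hσ, sum_code_update_next hi, hsum]

theorem IsRun.snoc {N : ℕ} {σ : ℕ → Status n} (hrun : IsRun M q p u N σ) {κ : Kind}
    (hpivot : Pivot M q p u κ (σ N) s) : IsRun M q p u (N + 1) (Function.update σ (N + 1) s) := by
  refine ⟨by rw [Function.update_of_ne (by omega), hrun.1], fun k hk => ?_⟩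
  rw [Function.update_of_ne (by omega : k ≠ N + 1)]
  obtain hkN | rfl := Nat.lt_succ_iff_lt_or_eq.1 hk
  · rw [Function.update_of_ne (by omega)]
    exact hrun.2 k hkN
  · rw [Function.update_self]
    exact ⟨κ, hpivot⟩

/-! ### Tableaus -/

/-- The dependent variables at the index triple `s`, for `w = a q + b p + M x`: the entries of
`x` in the basic positions and the entries of `w` in the other ones. -/
noncomputable def rowVar (M : Matrix (Fin n) (Fin n) ℝ) (q p : Fin n → ℝ) (s : Status n)
    (a b : ℝ) (x : Fin n → ℝ) : Fin n → ℝ := fun i =>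
  if s i = Pos.basic then x i else a * q i + b * p i + (M *ᵥ x) i

/-- The independent variables at the index triple `s`: the entries of `w = a q + b p + M x` in
the basic positions and the distances of `x` from its bounds, scaled by `a`, in the other ones. -/
noncomputable def colVar (M : Matrix (Fin n) (Fin n) ℝ) (q p : Fin n → ℝ) (u : Fin n → EReal)
    (s : Status n) (a b : ℝ) (x : Fin n → ℝ) : Fin n → ℝ := fun i =>
  match s i with
  | Pos.basic => a * q i + b * p i + (M *ᵥ x) i
  | Pos.lower => x i
  | Pos.upper => x i - a * (u i).toReal

/-- The sequence `z₀, …, z_{n-1}, a, b, b, …`, by which the rows of a tableau are multiplied. -/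
noncomputable def extend (z : Fin n → ℝ) (a b : ℝ) : ℕ → ℝ := fun k =>
  if h : k < n then z ⟨k, h⟩ else if k = n then a else b

/-- `A` is the tableau of the algorithm at the index triple `s`: it expresses the dependent
variables by the independent ones. Its columns `n` and `n + 1` hold the coefficients of `a` and
`b`, hence `q̄` and `p̄` up to signs. -/
def IsTableau (M : Matrix (Fin n) (Fin n) ℝ) (q p : Fin n → ℝ) (u : Fin n → EReal)
    (s : Status n) (A : ℕ → ℕ → ℝ) : Prop :=
  ∀ (a b : ℝ) (x : Fin n → ℝ) (i : Fin n), rowVar M q p s a b x i =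
    ∑ k ∈ Finset.range (n + 2), A i k * extend (colVar M q p u s a b x) a b k

theorem sum_mul_extend (c : ℕ → ℝ) (z : Fin n → ℝ) (a b : ℝ) :
    ∑ k ∈ Finset.range (n + 2), c k * extend z a b k =
      ∑ i : Fin n, c i * z i + c n * a + c (n + 1) * b := by
  rw [Finset.sum_range_succ, Finset.sum_range_succ, Finset.sum_range]
  simp [extend]

theorem extend_update (z : Fin n → ℝ) (a b r : ℝ) (i : Fin n) :
    extend (Function.update z i r) a b = Function.update (extend z a b) i r := by
  funext k
  obtain rfl | hk := eq_or_ne k i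
  · simp [extend]
  · simp [extend, Fin.ext_iff, hk]

theorem IsTableau.congr (hA : IsTableau M q p u s A) {B : ℕ → ℕ → ℝ}
    (hAB : ∀ j < n, ∀ k < n + 2, B j k = A j k) : IsTableau M q p u s B := by
  intro a b x i
  rw [hA a b x i]
  exact Finset.sum_congr rfl fun k hk => by rw [hAB i i.2 k (Finset.mem_range.1 hk)]

theorem isTableau_initial (hM : ∀ i j : Fin n, A i j = M i j) (hq : ∀ i : Fin n, A i n = q i)
    (hp : ∀ i : Fin n, A i (n + 1) = p i) : IsTableau M q p u (initial n) A := by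
  intro a b x i
  simp only [sum_mul_extend, hq, hp, rowVar, colVar, initial, hM, mulVec, dotProduct, reduceCtorEq,
    if_false]
  ring

theorem IsTableau.apply_n (hA : IsTableau M q p u s A) (hs : Regular M s) (i : Fin n) :
    A i n = if s i = Pos.basic then -qbar M q u s i else qbar M q u s i := by
  have hcol : colVar M q p u s 1 0 (solution M q u s) = 0 := by
    funext j
    unfold colVar
    cases hj : s j
    · simp [solution_of_lower hj]
    · simpa using gradient_solution_of_basic (q := q) (u := u) hs hj
    · simp [solution_of_upper hj]
  have hrow := hA 1 0 (solution M q u s) i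
  rw [sum_mul_extend, hcol] at hrow
  simp only [Pi.zero_apply, mul_zero, Finset.sum_const_zero, zero_add, mul_one, add_zero] at hrow
  rw [← hrow, rowVar]
  split_ifs with hi
  · exact solution_of_basic hi
  · simpa using gradient_solution_of_ne (q := q) (u := u) hi

theorem IsTableau.apply_n_add_one (hA : IsTableau M q p u s A) (hs : Regular M s) (i : Fin n) :
    A i (n + 1) = if s i = Pos.basic then -bar M s p i else bar M s p i := by
  have hcol : colVar M q p u s 0 1 (-basicSolve M s p) = 0 := by
    funext j
    unfold colVar
    cases hj : s j
    · simp [basicSolve_of_ne, hj]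
    · simp [mulVec_neg, mulVec_basicSolve hs p hj]
    · simp [basicSolve_of_ne, hj]
  have hrow := hA 0 1 (-basicSolve M s p) i
  rw [sum_mul_extend, hcol] at hrow
  simp only [Pi.zero_apply, mul_zero, Finset.sum_const_zero, zero_add, mul_one] at hrow
  rw [← hrow, rowVar]
  split_ifs with hi
  · simp [bar_of_basic hi]
  · simp [bar_of_ne hi, mulVec_neg, sub_eq_add_neg]

theorem IsTableau.apply_of_colVar (hA : IsTableau M q p u s A)
    (hx : colVar M q p u s 0 0 x = Pi.single i 1) (j : Fin n) : A j i = rowVar M q p s 0 0 x j := by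
  rw [hA 0 0 x j, sum_mul_extend, hx]
  simp [Pi.single_apply]

theorem IsTableau.diag_of_lower (hA : IsTableau M q p u s A) (hs : Regular M s)
    (hi : s i = Pos.lower) : A i i = schurDiag M s i := by
  have hcol : colVar M q p u s 0 0 (Pi.single i 1 - mhat M s i) = Pi.single i 1 := by
    funext j
    have hne : s j ≠ Pos.lower → j ≠ i := fun hj hji => hj (hji ▸ hi)
    cases hj : s j
    · simp [colVar, mhat_of_ne, hj]
    · simp [colVar, mulVec_single_sub_mhat hs hj, hj, hne]
    · simp [colVar, mhat_of_ne, hj]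
  rw [hA.apply_of_colVar hcol, schurDiag_eq]
  simp [rowVar, hi]

theorem basicSolve_single_ne_zero (hM : M.PosSemidef) (hs : Regular M s) (hi : s i = Pos.basic) :
    basicSolve M s (Pi.single i 1) i ≠ 0 := by
  set x := basicSolve M s (Pi.single i 1)
  have hMx : ∀ j, s j = Pos.basic → (M *ᵥ x) j = (Pi.single i 1 : Fin n → ℝ) j :=
    fun j hj => mulVec_basicSolve hs _ hj
  have hquad : x ⬝ᵥ (M *ᵥ x) = x i := by
    rw [dotProduct, Finset.sum_eq_single i _ (by simp), hMx i hi, Pi.single_eq_same, mul_one]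
    intro j _ hji
    by_cases hj : s j = Pos.basic
    · rw [hMx j hj, Pi.single_eq_of_ne hji, mul_zero]
    · rw [show x j = 0 from basicSolve_of_ne hj, zero_mul]
  intro hxi
  have hker : M *ᵥ x = 0 := (hM.dotProduct_mulVec_zero_iff x).1 (by simp [hquad, hxi])
  simpa [hker] using hMx i hi

theorem IsTableau.diag_of_basic (hA : IsTableau M q p u s A) (hs : Regular M s)
    (hi : s i = Pos.basic) : A i i = basicSolve M s (Pi.single i 1) i := by
  have hcol : colVar M q p u s 0 0 (basicSolve M s (Pi.single i 1)) = Pi.single i 1 := by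
    funext j
    have hne : s j ≠ Pos.basic → j ≠ i := fun hj hji => hj (hji ▸ hi)
    cases hj : s j
    · simp [colVar, basicSolve_of_ne, hj, hne]
    · simp [colVar, mulVec_basicSolve hs _ hj, hj]
    · simp [colVar, basicSolve_of_ne, hj, hne]
  rw [hA.apply_of_colVar hcol, rowVar, if_pos hi]

theorem IsTableau.diag_ne_zero (hA : IsTableau M q (M *ᵥ d) u s A) (hM : M.PosSemidef)
    (hs : Regular M s) (hi : ratio M q (M *ᵥ d) u s i ≠ 0) : A i i ≠ 0 := by
  rcases lowerRatio_or_upperRatio hi with hlower | hbasic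
  · rw [hA.diag_of_lower hs hlower.1]
    exact (schurDiag_pos_of_lowerRatio hM hs hlower).ne'
  · rw [hA.diag_of_basic hs hbasic.1]
    exact basicSolve_single_ne_zero hM hs hbasic.1

/-- The principal pivot on the entry `(r, r)`, which exchanges the `r`-th dependent and the `r`-th
independent variable. -/
noncomputable def principalPivot (A : ℕ → ℕ → ℝ) (r : ℕ) : ℕ → ℕ → ℝ := fun j k =>
  if j = r then (if k = r then 1 / A r r else 0 - A r k / A r r)
  else (if k = r then A j r / A r r else A j k - A j r * A r k / A r r)

/-- Addition of `v` times column `r` to column `c`, which subtracts `v` times the `c`-th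
independent variable from the `r`-th one. -/
noncomputable def addColumn (A : ℕ → ℕ → ℝ) (r c : ℕ) (v : ℝ) : ℕ → ℕ → ℝ := fun j k =>
  if k = c then A j k + A j r * v else A j k

theorem sum_principalPivot {S : Finset ℕ} {r : ℕ} (hr : r ∈ S) (hA : A r r ≠ 0) (z : ℕ → ℝ)
    (j : ℕ) :
    ∑ k ∈ S, principalPivot A r j k * Function.update z r (∑ k ∈ S, A r k * z k) k =
      if j = r then z r else ∑ k ∈ S, A j k * z k := by
  have hdiag : principalPivot A r j r * A r r = if j = r then 1 else A j r := by
    rw [principalPivot, if_pos rfl, if_pos rfl]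
    split_ifs <;> field_simp
  have hoff : ∀ k ≠ r, principalPivot A r j k + principalPivot A r j r * A r k =
      if j = r then 0 else A j k := by
    intro k hk
    simp only [principalPivot, hk, if_true, if_false]
    split_ifs <;> field_simp <;> ring
  have hupdate : ∀ y, ∑ k ∈ S.erase r, principalPivot A r j k * Function.update z r y k =
      ∑ k ∈ S.erase r, principalPivot A r j k * z k := fun y =>
    Finset.sum_congr rfl fun k hk => by rw [Function.update_of_ne (Finset.ne_of_mem_erase hk)]
  calc _ = principalPivot A r j r * A r r * z r +
        ∑ k ∈ S.erase r, (principalPivot A r j k + principalPivot A r j r * A r k) * z k := by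
        rw [← Finset.add_sum_erase S _ hr, ← Finset.add_sum_erase S (fun k => A r k * z k) hr,
          Function.update_self, hupdate]
        simp only [add_mul, mul_add, Finset.sum_add_distrib, Finset.mul_sum, mul_assoc]
        ring
    _ = _ := by
        rw [hdiag, Finset.sum_congr rfl fun k hk => by rw [hoff k (Finset.ne_of_mem_erase hk)],
          ← Finset.add_sum_erase S (fun k => A j k * z k) hr]
        split_ifs <;> simp

theorem sum_addColumn {S : Finset ℕ} {r c : ℕ} (hr : r ∈ S) (hc : c ∈ S) (hrc : r ≠ c) (v : ℝ)
    (z : ℕ → ℝ) (j : ℕ) :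
    ∑ k ∈ S, addColumn A r c v j k * Function.update z r (z r - z c * v) k =
      ∑ k ∈ S, A j k * z k := by
  have hterm : ∀ k, addColumn A r c v j k * Function.update z r (z r - z c * v) k =
      A j k * z k + ((if k = c then A j r * v * z c else 0) -
        if k = r then A j r * v * z c else 0) := by
    intro k
    obtain rfl | hkr := eq_or_ne k r
    · simp [addColumn, hrc]
      ring
    · obtain rfl | hkc := eq_or_ne k c
      · simp [addColumn, hkr]
        ring
      · simp [addColumn, hkr, hkc]
  simp only [hterm, Finset.sum_add_distrib, Finset.sum_sub_distrib, Finset.sum_ite_eq', hr, hc,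
    if_true, sub_self, add_zero]

/-- The tableau after the diagonal pivot at `i`. The shift of the last but one column accounts for
the change of the bound of a basic variable that becomes nonbasic at its upper bound. -/
noncomputable def pivotTableau (A : ℕ → ℕ → ℝ) (u : Fin n → EReal) (s : Status n) (i : Fin n) :
    ℕ → ℕ → ℝ :=
  addColumn (principalPivot A i) i n (if s i = Pos.basic then (u i).toReal else 0)

theorem IsTableau.pivot (hA : IsTableau M q p u s A) (hi : s i ≠ Pos.upper) (hii : A i i ≠ 0) :
    IsTableau M q p u (Function.update s i (s i).next) (pivotTableau A u s i) := by
  intro a b x j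
  set v := if s i = Pos.basic then (u i).toReal else 0 with hv
  set z := extend (colVar M q p u s a b x) a b with hz
  have hcol : extend (colVar M q p u (Function.update s i (s i).next) a b x) a b =
      Function.update (Function.update z i (rowVar M q p s a b x i)) i
        (rowVar M q p s a b x i - a * v) := by
    rw [Function.update_idem, hz, ← extend_update]
    congr 1
    funext k
    obtain rfl | hk := eq_or_ne k i
    · cases hk : s k <;> simp_all [colVar, rowVar, Pos.next]
    · simp [colVar, hk]
  have hrow : rowVar M q p (Function.update s i (s i).next) a b x j =
      if (j : ℕ) = i then z i else rowVar M q p s a b x j := by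
    rw [hz]
    obtain rfl | hj := eq_or_ne j i
    · cases hj : s j <;> simp_all [colVar, rowVar, Pos.next, extend]
    · simp [rowVar, hj, Fin.val_inj]
  have hshift := sum_addColumn (A := principalPivot A i) (S := Finset.range (n + 2)) (r := i)
    (c := n) (by simp; omega) (by simp) (by omega) v
    (Function.update z i (rowVar M q p s a b x i)) j
  rw [Function.update_self, Function.update_of_ne (by omega), show z n = a by simp [hz, extend]]
    at hshift
  rw [hrow, hcol, pivotTableau, hshift, hA a b x i, hA a b x j,
    sum_principalPivot (Finset.mem_range.2 (by omega)) hii]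

theorem IsTableau.ratio_eq (hA : IsTableau M q p u s A) (hs : Regular M s) (i : Fin n) :
    ratio M q p u s i =
      if s i = Pos.lower ∧ 0 < A i (n + 1) then 0 - A i n / A i (n + 1)
      else if s i = Pos.basic ∧ A i (n + 1) < 0 ∧ u i < ⊤ then
        ((u i).toReal - A i n) / A i (n + 1)
      else 0 := by
  rw [ratio, hA.apply_n hs, hA.apply_n_add_one hs]
  cases hi : s i
  · simp
  · simp [div_neg]
  · simp

theorem IsTableau.solution_eq (hA : IsTableau M q p u s A) (hs : Regular M s) (i : Fin n) :
    solution M q u s i =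
      if s i = Pos.basic then A i n else if s i = Pos.upper then (u i).toReal else 0 := by
  rw [hA.apply_n hs, solution]
  cases s i <;> simp

/-! ### Programs: locality, loops, running time -/

/-- The parts of a memory that an assignment affects: a single register or a whole array. -/
inductive Loc
  | reg (v : ℕ)
  | nat (a : ℕ)
  | real (a : ℕ)
  deriving DecidableEq

/-- The parts of the memory to which a program may write. -/
def Prog.writes : Prog → Finset Loc
  | .skip => ∅
  | .setReg v _ => {.reg v}
  | .setNat a _ _ _ => {.nat a}
  | .setReal a _ _ _ => {.real a}
  | .seq c d => c.writes ∪ d.writes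
  | .ite _ c d => c.writes ∪ d.writes
  | .loop v _ c => insert (.reg v) c.writes

variable {S T : Finset Loc} {m m' m₁ m₂ m₃ : Mem} {c : Prog} {v a N K : ℕ} {e : NExp}
  {g : ℕ → ℕ → ℝ}

/-- The memories `m` and `m'` differ at most in the parts that belong to `S`. -/
structure AgreeOff (S : Finset Loc) (m m' : Mem) : Prop where
  reg : ∀ {v}, Loc.reg v ∉ S → m'.reg v = m.reg v
  nat : ∀ {a}, Loc.nat a ∉ S → m'.nat a = m.nat a
  real : ∀ {a}, Loc.real a ∉ S → m'.real a = m.real a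

theorem AgreeOff.refl (S : Finset Loc) (m : Mem) : AgreeOff S m m :=
  ⟨fun _ => rfl, fun _ => rfl, fun _ => rfl⟩

theorem AgreeOff.trans (h : AgreeOff S m₁ m₂) (h' : AgreeOff S m₂ m₃) : AgreeOff S m₁ m₃ :=
  ⟨fun hv => (h'.reg hv).trans (h.reg hv), fun ha => (h'.nat ha).trans (h.nat ha),
    fun ha => (h'.real ha).trans (h.real ha)⟩

theorem AgreeOff.mono (h : AgreeOff S m₁ m₂) (hST : S ⊆ T) : AgreeOff T m₁ m₂ :=
  ⟨fun hv => h.reg (mt (@hST _) hv), fun ha => h.nat (mt (@hST _) ha),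
    fun ha => h.real (mt (@hST _) ha)⟩

theorem agreeOff_setReg (m : Mem) (v k : ℕ) : AgreeOff {.reg v} m (m.setReg v k) :=
  ⟨fun hw => Function.update_of_ne (by simpa using hw) _ _, fun _ => rfl, fun _ => rfl⟩

theorem agreeOff_setNat (m : Mem) (a i j k : ℕ) : AgreeOff {.nat a} m (m.setNat a i j k) :=
  ⟨fun _ => rfl, fun hb => Function.update_of_ne (by simpa using hb) _ _, fun _ => rfl⟩

theorem agreeOff_setReal (m : Mem) (a i j : ℕ) (x : ℝ) :
    AgreeOff {.real a} m (m.setReal a i j x) :=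
  ⟨fun _ => rfl, fun _ => rfl, fun hb => Function.update_of_ne (by simpa using hb) _ _⟩

theorem iterate_induction {f : ℕ → Mem → Mem} {I : ℕ → Mem → Prop} (h0 : I 0 m)
    (hstep : ∀ k < N, ∀ m', I k m' → I (k + 1) (f k m')) : I N (iterate f N m) := by
  induction N with
  | zero => exact h0
  | succ N ih => exact hstep N N.lt_succ_self _ (ih fun k hk => hstep k (hk.trans N.lt_succ_self))

theorem agreeOff_iterate (hc : ∀ m, AgreeOff c.writes m (c.exec m)) (v N : ℕ) (m : Mem) :
    AgreeOff (insert (.reg v) c.writes) m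
      (iterate (fun k m' => c.exec (m'.setReg v k)) N m) := by
  refine iterate_induction (I := fun _ => AgreeOff (insert (.reg v) c.writes) m)
    (.refl _ m) fun k _ m' hm' => hm'.trans ?_
  exact ((agreeOff_setReg m' v k).mono (by simp)).trans
    ((hc _).mono (Finset.subset_insert _ _))

theorem exec_agreeOff (c : Prog) (m : Mem) : AgreeOff c.writes m (c.exec m) := by
  induction c generalizing m with
  | skip => exact .refl _ m
  | setReg v e => exact agreeOff_setReg m _ _
  | setNat a i j e => exact agreeOff_setNat m _ _ _ _
  | setReal a i j e => exact agreeOff_setReal m _ _ _ _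
  | seq c d hc hd =>
    exact ((hc m).mono Finset.subset_union_left).trans ((hd _).mono Finset.subset_union_right)
  | ite b c d hc hd =>
    rw [Prog.exec]
    split_ifs
    exacts [(hc m).mono Finset.subset_union_left, (hd m).mono Finset.subset_union_right]
  | loop v e c hc => exact agreeOff_iterate hc v _ m

theorem exec_loop_induction {I : ℕ → Mem → Prop} (he : e.eval m = N) (h0 : I 0 m)
    (hstep : ∀ k < N, ∀ m', AgreeOff (Prog.loop v e c).writes m m' → I k m' →
      I (k + 1) (c.exec (m'.setReg v k))) :
    I N ((Prog.loop v e c).exec m) := by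
  rw [Prog.exec, he]
  refine (iterate_induction
    (I := fun k m' => AgreeOff (Prog.loop v e c).writes m m' ∧ I k m')
    ⟨.refl _ m, h0⟩ fun k hk m' hm' => ⟨hm'.1.trans ?_, hstep k hk m' hm'.1 hm'.2⟩).2
  exact ((agreeOff_setReg m' v k).mono (by simp [Prog.writes])).trans
    ((exec_agreeOff c _).mono (Finset.subset_insert _ _))

/-- Execution of `c` at all entries `(i, j)` of a table, with `i` in register `3` and `j` in
register `4`. -/
def Prog.nested (rows cols : NExp) (c : Prog) : Prog :=
  .loop 3 rows (.loop 4 cols c)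

theorem exec_nested_induction {rows cols : NExp} {I : ℕ → ℕ → (ℕ → ℕ → ℝ) → Prop}
    (hc : c.writes ⊆ {.real a}) (hrows : rows.eval m = N)
    (hcols : ∀ m', AgreeOff {.reg 3, .reg 4, .real a} m m' → cols.eval m' = K)
    (h0 : I 0 0 (m.real a)) (hrow : ∀ j A, I j K A → I (j + 1) 0 A)
    (hstep : ∀ m', AgreeOff {.reg 3, .reg 4, .real a} m m' → m'.reg 3 < N → m'.reg 4 < K →
      I (m'.reg 3) (m'.reg 4) (m'.real a) →
      I (m'.reg 3) (m'.reg 4 + 1) ((c.exec m').real a)) :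
    I N 0 (((Prog.nested rows cols c).exec m).real a) := by
  have hinner : (Prog.loop 4 cols c).writes ⊆ {.reg 4, .real a} :=
    Finset.insert_subset_insert _ hc
  have houter : (Prog.nested rows cols c).writes ⊆ {.reg 3, .reg 4, .real a} :=
    Finset.insert_subset_insert _ hinner
  refine exec_loop_induction (I := fun j m' => I j 0 (m'.real a)) hrows h0
    fun j hj m₁ hm₁ hI => hrow j _ ?_
  have hm₂ : AgreeOff {.reg 3, .reg 4, .real a} m (m₁.setReg 3 j) :=
    (hm₁.mono houter).trans ((agreeOff_setReg m₁ 3 j).mono (by simp))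
  refine exec_loop_induction (I := fun k m' => I j k (m'.real a)) (hcols _ hm₂) hI
    fun k hk m₃ hm₃ hI => ?_
  have hm₄ : AgreeOff {.reg 4, .real a} (m₁.setReg 3 j) (m₃.setReg 4 k) :=
    (hm₃.mono hinner).trans ((agreeOff_setReg m₃ 4 k).mono (by simp))
  have h3 : (m₃.setReg 4 k).reg 3 = j := by simpa [Mem.setReg] using hm₄.reg (v := 3) (by simp)
  have h4 : (m₃.setReg 4 k).reg 4 = k := by simp [Mem.setReg]
  have := hstep (m₃.setReg 4 k) (hm₂.trans (hm₄.mono (Finset.subset_insert _ _)))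
  rw [h3, h4] at this
  exact this hj hk hI

theorem exec_nested_of_eq_setReal {rows cols : NExp} (hc : c.writes ⊆ {.real a})
    (hrows : rows.eval m = N)
    (hcols : ∀ m', AgreeOff {.reg 3, .reg 4, .real a} m m' → cols.eval m' = K)
    (hexec : ∀ m', AgreeOff {.reg 3, .reg 4, .real a} m m' → m'.reg 3 < N → m'.reg 4 < K →
      c.exec m' = m'.setReal a (m'.reg 3) (m'.reg 4) (g (m'.reg 3) (m'.reg 4))) :
    ∀ j < N, ∀ k < K, ((Prog.nested rows cols c).exec m).real a j k = g j k := by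
  suffices h : ∀ j k, j < N ∧ k < K ∨ j = N ∧ k < 0 →
      ((Prog.nested rows cols c).exec m).real a j k = g j k from
    fun j hj k hk => h j k (Or.inl ⟨hj, hk⟩)
  refine exec_nested_induction
    (I := fun i l A => ∀ j k, j < i ∧ k < K ∨ j = i ∧ k < l → A j k = g j k)
    hc hrows hcols (by omega) (fun i A hA j k h => hA j k (by omega))
    fun m' hm' h3 h4 hI j k h => ?_
  rw [hexec m' hm' h3 h4]
  by_cases hjk : j = m'.reg 3 ∧ k = m'.reg 4
  · simp [Mem.setReal, hjk]
  · have := hI j k (by omega)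
    simp only [Mem.setReal, Function.update_self, Function.update_apply]
    split_ifs <;> simp_all

/-- Addition of the values of `e` in all columns `j < reg 0` to the entries `(i, 0)` of a real
array, for the rows `i < reg 0`. -/
def Prog.accumulate (a : ℕ) (e : RExp) : Prog :=
  .nested (.reg 0) (.reg 0)
    (.setReal a (.reg 3) (.const 0) (.add (.get a (.reg 3) (.const 0)) e))

theorem exec_accumulate {e : RExp} (hm : m.real a = 0)
    (he : ∀ m', AgreeOff {.reg 3, .reg 4, .real a} m m' → m'.reg 3 < m.reg 0 →
      m'.reg 4 < m.reg 0 → e.eval m' = g (m'.reg 3) (m'.reg 4)) :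
    ∀ j < m.reg 0, ((Prog.accumulate a e).exec m).real a j 0 =
      ∑ k ∈ Finset.range (m.reg 0), g j k := by
  suffices h : ∀ j, ((Prog.accumulate a e).exec m).real a j 0 =
      if j < m.reg 0 then ∑ k ∈ Finset.range (m.reg 0), g j k
      else if j = m.reg 0 then ∑ k ∈ Finset.range 0, g j k else 0 from
    fun j hj => (h j).trans (if_pos hj)
  refine exec_nested_induction (K := m.reg 0)
    (I := fun i l A => ∀ j, A j 0 = if j < i then ∑ k ∈ Finset.range (m.reg 0), g j k
      else if j = i then ∑ k ∈ Finset.range l, g j k else 0)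
    (by simp [Prog.writes]) rfl (fun m' hm' => hm'.reg (by simp)) (by simp [hm])
    (fun i A hA j => ?_) fun m' hm' h3 h4 hI j => ?_
  · rw [hA j]
    rcases lt_trichotomy j i with hj | rfl | hj
    · simp [hj, hj.trans i.lt_succ_self]
    · simp
    · simp [hj.not_gt, hj.ne', (Nat.succ_le_of_lt hj).not_gt]
  · simp only [Prog.exec, Mem.setReal, RExp.eval, NExp.eval, Function.update_self,
      he m' hm' h3 h4, hI]
    obtain rfl | hj := eq_or_ne j (m'.reg 3)
    · simp [Finset.sum_range_succ]
    · simp [hj, hI]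

/-- The expression is bounded by a multiple of register `0`, which holds the dimension. -/
def NExp.IsLinear (e : NExp) : Prop :=
  ∃ C, ∀ m : Mem, 0 < m.reg 0 → e.eval m ≤ C * m.reg 0

theorem NExp.isLinear_const (k : ℕ) : (NExp.const k).IsLinear :=
  ⟨k, fun _ hm => Nat.le_mul_of_pos_right k hm⟩

theorem NExp.isLinear_reg_zero : (NExp.reg 0).IsLinear :=
  ⟨1, fun m _ => (one_mul (m.reg 0)).ge⟩

theorem NExp.IsLinear.add {e f : NExp} (he : e.IsLinear) (hf : f.IsLinear) :
    (NExp.add e f).IsLinear := by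
  obtain ⟨C, hC⟩ := he
  obtain ⟨D, hD⟩ := hf
  exact ⟨C + D, fun m hm => (Nat.add_le_add (hC m hm) (hD m hm)).trans_eq (add_mul ..).symm⟩

/-- All loops of the program have a number of passes that is linear in the dimension. -/
def Prog.HasLinearLoops : Prog → Prop
  | .seq c d => c.HasLinearLoops ∧ d.HasLinearLoops
  | .ite _ c d => c.HasLinearLoops ∧ d.HasLinearLoops
  | .loop _ e c => e.IsLinear ∧ c.HasLinearLoops
  | _ => True

/-- The maximal number of loops nested in one another. -/
def Prog.depth : Prog → ℕ
  | .seq c d => max c.depth d.depth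
  | .ite _ c d => max c.depth d.depth
  | .loop _ _ c => c.depth + 1
  | _ => 0

theorem exists_cost_loop_le {C : ℕ} {k : ℕ} (hc : ∀ m, 0 < m.reg 0 → c.cost m ≤ C * m.reg 0 ^ k)
    (hv : v ≠ 0) (h0 : Loc.reg 0 ∉ c.writes) (he : e.IsLinear) :
    ∃ D, ∀ m, 0 < m.reg 0 → (Prog.loop v e c).cost m ≤ D * m.reg 0 ^ (k + 1) := by
  obtain ⟨E, hE⟩ := he
  refine ⟨e.cost + 1 + E * (C + 1), fun m hm => ?_⟩
  have hpow : ∀ l, 1 ≤ m.reg 0 ^ l := fun l => Nat.one_le_pow _ _ hm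
  have hpass : ∀ l, c.cost ((iterate (fun k' m' => c.exec (m'.setReg v k')) l m).setReg v l) + 1 ≤
      (C + 1) * m.reg 0 ^ k := by
    intro l
    have hreg : ((iterate (fun k' m' => c.exec (m'.setReg v k')) l m).setReg v l).reg 0 =
        m.reg 0 :=
      ((agreeOff_setReg _ v l).reg (by simpa using hv.symm)).trans
        ((agreeOff_iterate (exec_agreeOff c) v l m).reg (by simp [hv.symm, h0]))
    have := hc _ (hreg ▸ hm)
    rw [hreg] at this
    linarith [hpow k]
  calc (Prog.loop v e c).cost m
      ≤ e.cost + 1 + ∑ l ∈ Finset.range (e.eval m), (C + 1) * m.reg 0 ^ k :=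
        Nat.add_le_add_left (Finset.sum_le_sum fun l _ => hpass l) _
    _ = e.cost + 1 + e.eval m * ((C + 1) * m.reg 0 ^ k) := by simp
    _ ≤ (e.cost + 1) * m.reg 0 ^ (k + 1) + E * m.reg 0 * ((C + 1) * m.reg 0 ^ k) :=
        Nat.add_le_add (Nat.le_mul_of_pos_right _ (hpow _)) (Nat.mul_le_mul_right _ (hE m hm))
    _ = (e.cost + 1 + E * (C + 1)) * m.reg 0 ^ (k + 1) := by ring

theorem Prog.HasLinearLoops.exists_cost_le (hc : c.HasLinearLoops) (h0 : Loc.reg 0 ∉ c.writes) :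
    ∃ C, ∀ m, 0 < m.reg 0 → c.cost m ≤ C * m.reg 0 ^ c.depth := by
  induction c with
  | skip | setReg | setNat | setReal => exact ⟨_, fun m _ => (Nat.mul_one _).ge⟩
  | seq c d ihc ihd =>
    simp only [Prog.writes, Finset.mem_union, not_or] at h0
    obtain ⟨C, hC⟩ := ihc hc.1 h0.1
    obtain ⟨D, hD⟩ := ihd hc.2 h0.2
    refine ⟨C + D, fun m hm => ?_⟩
    have hreg := (exec_agreeOff c m).reg h0.1
    have hle := hD (c.exec m) (hreg ▸ hm)
    rw [hreg] at hle
    rw [add_mul]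
    exact Nat.add_le_add
      ((hC m hm).trans (Nat.mul_le_mul_left _ (Nat.pow_le_pow_right hm (le_max_left _ _))))
      (hle.trans (Nat.mul_le_mul_left _ (Nat.pow_le_pow_right hm (le_max_right _ _))))
  | ite b c d ihc ihd =>
    simp only [Prog.writes, Finset.mem_union, not_or] at h0
    obtain ⟨C, hC⟩ := ihc hc.1 h0.1
    obtain ⟨D, hD⟩ := ihd hc.2 h0.2
    refine ⟨b.cost + (C + D) + 1, fun m hm => ?_⟩
    have hleft : m.reg 0 ^ c.depth ≤ m.reg 0 ^ max c.depth d.depth :=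
      Nat.pow_le_pow_right hm (le_max_left _ _)
    have hright : m.reg 0 ^ d.depth ≤ m.reg 0 ^ max c.depth d.depth :=
      Nat.pow_le_pow_right hm (le_max_right _ _)
    have hone : 1 ≤ m.reg 0 ^ max c.depth d.depth := Nat.one_le_pow _ _ hm
    rw [Prog.cost, Prog.depth]
    split_ifs
    · nlinarith [hC m hm, hleft, hone]
    · nlinarith [hD m hm, hright, hone]
  | loop v e c ih =>
    simp only [Prog.writes, Finset.mem_insert, not_or, Loc.reg.injEq] at h0
    obtain ⟨C, hC⟩ := ih hc.2 h0.2
    exact exists_cost_loop_le hC (Ne.symm h0.1) h0.2 hc.1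

/-! ### The algorithm as a program

Besides the input and output locations, real array `5` holds the critical value in the entry
`(0, 0)` and the shift of a tableau column in `(0, 1)`, real array `7` the tableau, `6` its
principal pivot, `8` the vector `p` and `9` the ratios. Registers `3`, `4`, `5` count passes, and
register `6` holds the pivot index. -/

theorem Pos.code_inj {v w : Pos} : v.code = w.code ↔ v = w := by
  cases v <;> cases w <;> simp [code]

/-- Assignment to the entry of a real array that is current inside `Prog.nested`. -/
def Prog.put (a : ℕ) (e : RExp) : Prog :=
  .setReal a (.reg 3) (.reg 4) e

/-- The index `i` in the given register is currently in the position `v`. -/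
def Test.position (i : ℕ) (v : Pos) : Test :=
  .natEq (.get 1 (.reg 1) (.reg i)) (.const v.code)

/-- Computation of the vector `p = M d`. -/
def vectorProg : Prog :=
  .accumulate 8 (.mul (.get 0 (.reg 3) (.reg 4)) (.get 2 (.reg 4) (.const 0)))

/-- Computation of the vector `p` and of the tableau at the initial index triple. -/
def setupProg : Prog :=
  .seq vectorProg (.nested (.reg 0) (.add (.reg 0) (.const 2))
    (.ite (.natLt (.reg 4) (.reg 0)) (.put 7 (.get 0 (.reg 3) (.reg 4)))
      (.ite (.natEq (.reg 4) (.reg 0)) (.put 7 (.get 1 (.reg 3) (.const 0)))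
        (.put 7 (.get 8 (.reg 3) (.const 0))))))

/-- Computation of all ratios of the first ratio test. -/
def ratioProg : Prog :=
  .nested (.reg 0) (.const 1)
    (.ite (.and (.position 3 .lower)
        (.realLt .zero (.get 7 (.reg 3) (.add (.reg 0) (.const 1)))))
      (.put 9 (.sub .zero
        (.div (.get 7 (.reg 3) (.reg 0)) (.get 7 (.reg 3) (.add (.reg 0) (.const 1))))))
      (.ite (.and (.position 3 .basic)
          (.and (.realLt (.get 7 (.reg 3) (.add (.reg 0) (.const 1))) .zero)
            (.natEq (.get 0 (.reg 3) (.const 0)) (.const 1))))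
        (.put 9 (.div (.sub (.get 3 (.reg 3) (.const 0)) (.get 7 (.reg 3) (.reg 0)))
          (.get 7 (.reg 3) (.add (.reg 0) (.const 1)))))
        (.put 9 .zero)))

/-- Maximization of the ratios. -/
def maximumProg : Prog :=
  .seq (.setReal 5 (.const 0) (.const 0) .zero)
    (.loop 3 (.reg 0)
      (.ite (.realLt (.get 5 (.const 0) (.const 0)) (.get 9 (.reg 3) (.const 0)))
        (.seq (.setReal 5 (.const 0) (.const 0) (.get 9 (.reg 3) (.const 0)))
          (.setReg 6 (.reg 3)))
        .skip))

/-- Computation of the principal pivot of the tableau. -/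
def principalPivotProg : Prog :=
  .nested (.reg 0) (.add (.reg 0) (.const 2))
    (.ite (.natEq (.reg 3) (.reg 6))
      (.ite (.natEq (.reg 4) (.reg 6))
        (.put 6 (.div .one (.get 7 (.reg 6) (.reg 6))))
        (.put 6 (.sub .zero (.div (.get 7 (.reg 6) (.reg 4)) (.get 7 (.reg 6) (.reg 6))))))
      (.ite (.natEq (.reg 4) (.reg 6))
        (.put 6 (.div (.get 7 (.reg 3) (.reg 6)) (.get 7 (.reg 6) (.reg 6))))
        (.put 6 (.sub (.get 7 (.reg 3) (.reg 4))
          (.div (.mul (.get 7 (.reg 3) (.reg 6)) (.get 7 (.reg 6) (.reg 4)))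
            (.get 7 (.reg 6) (.reg 6)))))))

/-- Determination of the shift by which the last but one column of the tableau changes. -/
def shiftProg : Prog :=
  .ite (.position 6 .basic)
    (.setReal 5 (.const 0) (.const 1) (.get 3 (.reg 6) (.const 0)))
    (.setReal 5 (.const 0) (.const 1) .zero)

/-- Computation of the new tableau from the principal pivot and the shift. -/
def addColumnProg : Prog :=
  .nested (.reg 0) (.add (.reg 0) (.const 2))
    (.ite (.natEq (.reg 4) (.reg 0))
      (.put 7 (.add (.get 6 (.reg 3) (.reg 4))
        (.mul (.get 6 (.reg 3) (.reg 6)) (.get 5 (.const 0) (.const 1)))))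
      (.put 7 (.get 6 (.reg 3) (.reg 4))))

/-- Copy of the current index triple to the next row of the record. -/
def copyProg : Prog :=
  .loop 3 (.reg 0) (.setNat 1 (.add (.reg 1) (.const 1)) (.reg 3) (.get 1 (.reg 1) (.reg 3)))

/-- Recording of the new index triple, in which the position of the pivot index is the next one. -/
def recordProg : Prog :=
  .seq copyProg
    (.seq (.setNat 1 (.add (.reg 1) (.const 1)) (.reg 6)
        (.add (.get 1 (.reg 1) (.reg 6)) (.const 1)))
      (.setReg 1 (.add (.reg 1) (.const 1))))

/-- Update of the tableau by a pivot at the index in register `6`. -/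
def tableauProg : Prog :=
  .seq principalPivotProg (.seq shiftProg addColumnProg)

/-- A pivot at the index in register `6`. -/
def pivotProg : Prog :=
  .seq tableauProg recordProg

/-- The first ratio test. -/
def selectProg : Prog :=
  .seq ratioProg maximumProg

/-- One iteration of the algorithm, which does nothing after the last pivot. -/
def stepProg : Prog :=
  .seq selectProg
    (.ite (.realLt .zero (.get 5 (.const 0) (.const 0))) pivotProg .skip)

/-- Output of the solution. -/
def solutionProg : Prog :=
  .nested (.reg 0) (.const 1)
    (.ite (.position 3 .basic) (.put 4 (.get 7 (.reg 3) (.reg 0)))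
      (.ite (.position 3 .upper) (.put 4 (.get 3 (.reg 3) (.const 0))) (.put 4 .zero)))

/-- The whole algorithm. It makes at most `2 n` pivots, since each of them raises the sum of the
codes of the positions by one. -/
def pppaProg : Prog :=
  .seq setupProg (.seq (.loop 5 (.add (.reg 0) (.reg 0)) stepProg) solutionProg)

theorem pppaProg_hasLinearLoops : pppaProg.HasLinearLoops := by
  have hn := NExp.isLinear_reg_zero
  have h1 := NExp.isLinear_const 1
  have h2 := hn.add (NExp.isLinear_const 2)
  have h3 := hn.add hn
  simp only [pppaProg, vectorProg, setupProg, stepProg, selectProg, solutionProg, ratioProg,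
    maximumProg, pivotProg, tableauProg, principalPivotProg, shiftProg, addColumnProg, copyProg,
    recordProg, Prog.nested, Prog.accumulate, Prog.put, Prog.HasLinearLoops, hn, h1, h2,
    h3, and_self]

theorem exists_cost_pppaProg_le :
    ∃ C, ∀ m : Mem, 0 < m.reg 0 → pppaProg.cost m ≤ C * m.reg 0 ^ 3 :=
  pppaProg_hasLinearLoops.exists_cost_le (by decide)

theorem exec_maximumProg (m : Mem) :
    let m' := maximumProg.exec m
    0 ≤ m'.real 5 0 0 ∧ (∀ j < m.reg 0, m.real 9 j 0 ≤ m'.real 5 0 0) ∧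
      (m'.real 5 0 0 = 0 ∨ m'.reg 6 < m.reg 0 ∧ m.real 9 (m'.reg 6) 0 = m'.real 5 0 0) := by
  refine exec_loop_induction (m := m.setReal 5 0 0 0) (N := m.reg 0)
    (I := fun k m' => 0 ≤ m'.real 5 0 0 ∧ (∀ j < k, m.real 9 j 0 ≤ m'.real 5 0 0) ∧
      (m'.real 5 0 0 = 0 ∨ m'.reg 6 < k ∧ m.real 9 (m'.reg 6) 0 = m'.real 5 0 0))
    rfl (by simp [Mem.setReal]) fun k hk m' hm' ⟨hpos, hle, heq⟩ => ?_
  have h9 : m'.real 9 = m.real 9 := hm'.real (by decide)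
  by_cases hlt : m'.real 5 0 0 < m.real 9 k 0
  · simp only [Prog.exec, Test.holds, RExp.eval, NExp.eval, Mem.setReg, Mem.setReal, h9,
      Function.update_self, hlt, if_true]
    refine ⟨hpos.trans hlt.le, fun j hj => ?_, Or.inr ⟨k.lt_succ_self, trivial⟩⟩
    obtain rfl | hjk := eq_or_ne j k
    · exact le_rfl
    · exact (hle j (by omega)).trans hlt.le
  · simp only [Prog.exec, Test.holds, RExp.eval, NExp.eval, Mem.setReg, h9, Function.update_self,
      hlt, if_false]
    refine ⟨hpos, fun j hj => ?_, heq.imp_right fun h => ⟨h.1.trans k.lt_succ_self, h.2⟩⟩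
    obtain rfl | hjk := eq_or_ne j k
    · exact not_lt.1 hlt
    · exact hle j (by omega)

theorem exec_principalPivotProg (m : Mem) : ∀ j < m.reg 0, ∀ k < m.reg 0 + 2,
    (principalPivotProg.exec m).real 6 j k = principalPivot (m.real 7) (m.reg 6) j k := by
  refine exec_nested_of_eq_setReal (by decide) rfl (fun m' hm' => ?_) fun m' hm' _ _ => ?_
  · simp only [NExp.eval, hm'.reg (v := 0) (by decide)]
  · simp only [Prog.exec, Prog.put, Test.holds, RExp.eval, NExp.eval, principalPivot,
      hm'.reg (v := 6) (by decide), hm'.real (a := 7) (by decide)]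
    split_ifs <;> rfl

theorem exec_addColumnProg (m : Mem) : ∀ j < m.reg 0, ∀ k < m.reg 0 + 2,
    (addColumnProg.exec m).real 7 j k =
      addColumn (m.real 6) (m.reg 6) (m.reg 0) (m.real 5 0 1) j k := by
  refine exec_nested_of_eq_setReal (by decide) rfl (fun m' hm' => ?_) fun m' hm' _ _ => ?_
  · simp only [NExp.eval, hm'.reg (v := 0) (by decide)]
  · simp only [Prog.exec, Prog.put, Test.holds, RExp.eval, NExp.eval, addColumn,
      hm'.reg (v := 0) (by decide), hm'.reg (v := 6) (by decide),
      hm'.real (a := 5) (by decide), hm'.real (a := 6) (by decide)]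
    split_ifs <;> rfl

theorem exec_copyProg (m : Mem) (k j : ℕ) : (copyProg.exec m).nat 1 k j =
    if k = m.reg 1 + 1 ∧ j < m.reg 0 then m.nat 1 (m.reg 1) j else m.nat 1 k j := by
  revert k j
  refine exec_loop_induction (I := fun l m' => ∀ k j, m'.nat 1 k j =
    if k = m.reg 1 + 1 ∧ j < l then m.nat 1 (m.reg 1) j else m.nat 1 k j)
    rfl (by simp) fun l _ m' hm' hI k j => ?_
  have h1 : m'.reg 1 = m.reg 1 := hm'.reg (by decide)
  simp only [Prog.exec, NExp.eval, Mem.setReg, Mem.setNat, Function.update_self, ne_eq,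
    OfNat.one_ne_ofNat, not_false_eq_true, Function.update_of_ne, h1, hI, Function.update_apply]
  grind

theorem exec_recordProg_reg (m : Mem) : (recordProg.exec m).reg 1 = m.reg 1 + 1 := by
  have h1 : (copyProg.exec m).reg 1 = m.reg 1 := (exec_agreeOff copyProg m).reg (by decide)
  simp [recordProg, Prog.exec, NExp.eval, Mem.setReg, Mem.setNat, h1]

theorem exec_recordProg_nat (m : Mem) (k : ℕ) {j : ℕ} (hj : j < m.reg 0) :
    (recordProg.exec m).nat 1 k j = if k = m.reg 1 + 1 then
      m.nat 1 (m.reg 1) j + (if j = m.reg 6 then 1 else 0) else m.nat 1 k j := by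
  have h1 : (copyProg.exec m).reg 1 = m.reg 1 := (exec_agreeOff copyProg m).reg (by decide)
  have h6 : (copyProg.exec m).reg 6 = m.reg 6 := (exec_agreeOff copyProg m).reg (by decide)
  simp only [recordProg, Prog.exec, NExp.eval, Mem.setReg, Mem.setNat, Function.update_self,
    Function.update_apply, h1, h6, exec_copyProg]
  grind [exec_copyProg]

/-- The memory `m` holds the problem, the index triples `σ 0, …, σ N` of a run with `N` pivots,
where `N` is the content of register `1`, and a tableau at `σ N`. -/
structure Represents (M : Matrix (Fin n) (Fin n) ℝ) (q p : Fin n → ℝ) (u : Fin n → EReal)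
    (σ : ℕ → Status n) (m : Mem) : Prop where
  size : m.reg 0 = n
  result : m.reg 2 = 0
  flag : ∀ i : Fin n, m.nat 0 i 0 = 1 ↔ u i < ⊤
  bound : ∀ i : Fin n, m.real 3 i 0 = (u i).toReal
  run : IsRun M q p u (m.reg 1) σ
  status : ∀ k ≤ m.reg 1, ∀ i : Fin n, m.nat 1 k i = (σ k i).code
  tableau : IsTableau M q p u (σ (m.reg 1)) (m.real 7)

theorem Represents.of_agreeOff (hm : Represents M q p u σ m) (hagree : AgreeOff S m m')
    (hS : Disjoint S {.reg 0, .reg 1, .reg 2, .nat 0, .nat 1, .real 3, .real 7}) :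
    Represents M q p u σ m' := by
  rw [Finset.disjoint_right] at hS
  constructor <;> simp only [hagree.reg (hS (a := .reg 0) (by decide)),
    hagree.reg (hS (a := .reg 1) (by decide)), hagree.reg (hS (a := .reg 2) (by decide)),
    hagree.nat (hS (a := .nat 0) (by decide)), hagree.nat (hS (a := .nat 1) (by decide)),
    hagree.real (hS (a := .real 3) (by decide)), hagree.real (hS (a := .real 7) (by decide))]
  exacts [hm.size, hm.result, hm.flag, hm.bound, hm.run, hm.status, hm.tableau]

theorem Represents.position_holds (hm : Represents M q p u σ m) (hv : m.reg v = i) (w : Pos) :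
    (Test.position v w).holds m ↔ σ (m.reg 1) i = w := by
  simp only [Test.position, Test.holds, NExp.eval, hv, hm.status _ le_rfl, Pos.code_inj]

theorem exec_nested_const_one {f : Fin n → ℝ} (hc : c.writes ⊆ {.real a}) (hn : m.reg 0 = n)
    (hexec : ∀ m', AgreeOff {.reg 3, .reg 4, .real a} m m' → ∀ i : Fin n, m'.reg 3 = i →
      c.exec m' = m'.setReal a (m'.reg 3) (m'.reg 4) (f i)) (i : Fin n) :
    ((Prog.nested (.reg 0) (.const 1) c).exec m).real a i 0 = f i := by
  have h := exec_nested_of_eq_setReal (rows := .reg 0) (cols := .const 1) (K := 1)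
    (g := fun j _ => if h : j < n then f ⟨j, h⟩ else 0) hc hn (fun _ _ => rfl)
    fun m' hm' h3 _ => by rw [dif_pos h3, hexec m' hm' ⟨_, h3⟩ rfl]
  rw [h i i.2 0 one_pos, dif_pos i.2]

theorem Represents.exec_ratioProg (hm : Represents M q p u σ m) (hs : Regular M (σ (m.reg 1)))
    (i : Fin n) : (ratioProg.exec m).real 9 i 0 = ratio M q p u (σ (m.reg 1)) i := by
  refine exec_nested_const_one (by decide) hm.size (fun m' hm' i hi => ?_) i
  have h := hm.of_agreeOff hm' (by decide)
  have h1 : m'.reg 1 = m.reg 1 := hm'.reg (by decide)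
  rw [← h1] at hs ⊢
  rw [h.tableau.ratio_eq hs]
  simp only [Prog.exec, Prog.put, Test.holds, RExp.eval, NExp.eval, h.position_holds hi, hi,
    h.size, h.flag, h.bound]
  split_ifs <;> rfl

theorem Represents.exec_solutionProg (hm : Represents M q p u σ m)
    (hs : Regular M (σ (m.reg 1))) (i : Fin n) :
    (solutionProg.exec m).real 4 i 0 = solution M q u (σ (m.reg 1)) i := by
  refine exec_nested_const_one (by decide) hm.size (fun m' hm' i hi => ?_) i
  have h := hm.of_agreeOff hm' (by decide)
  have h1 : m'.reg 1 = m.reg 1 := hm'.reg (by decide)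
  rw [← h1] at hs ⊢
  rw [h.tableau.solution_eq hs]
  simp only [Prog.exec, Prog.put, RExp.eval, NExp.eval, h.position_holds hi, hi, h.size, h.bound]
  split_ifs <;> rfl

theorem Represents.exec_selectProg (hm : Represents M q p u σ m)
    (hs : Regular M (σ (m.reg 1))) :
    let m' := selectProg.exec m
    IsCritical M q p u (σ (m.reg 1)) (m'.real 5 0 0) ∧
      (m'.real 5 0 0 = 0 ∨ ∃ i : Fin n, m'.reg 6 = i ∧
        ratio M q p u (σ (m.reg 1)) i = m'.real 5 0 0) := by
  intro m'
  have hratio := hm.exec_ratioProg hs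
  have hsize := (hm.of_agreeOff (exec_agreeOff ratioProg m) (by decide)).size
  obtain ⟨hnonneg, hle, hmem⟩ := exec_maximumProg (ratioProg.exec m)
  have hattained : m'.real 5 0 0 = 0 ∨ ∃ i : Fin n, m'.reg 6 = i ∧
      ratio M q p u (σ (m.reg 1)) i = m'.real 5 0 0 :=
    hmem.imp_right fun ⟨hlt, heq⟩ =>
      ⟨⟨m'.reg 6, hsize ▸ hlt⟩, rfl, (hratio ⟨m'.reg 6, hsize ▸ hlt⟩).symm.trans heq⟩
  refine ⟨isCritical_iff.2 ⟨hattained.imp_right fun ⟨i, _, hi⟩ => ⟨i, hi⟩, ?_⟩, hattained⟩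
  rintro _ (rfl | ⟨i, rfl⟩)
  · exact hnonneg
  · exact (hratio i).symm.trans_le (hle i (hsize.symm ▸ i.2))

theorem Represents.exec_shiftProg (hm : Represents M q p u σ m) (hi : m.reg 6 = i) :
    (shiftProg.exec m).real 5 0 1 = if σ (m.reg 1) i = Pos.basic then (u i).toReal else 0 := by
  simp only [shiftProg, Prog.exec, hm.position_holds hi, RExp.eval, NExp.eval, hi, hm.bound]
  split_ifs <;> simp [Mem.setReal]

theorem Represents.exec_tableauProg (hm : Represents M q p u σ m) (hi : m.reg 6 = i) :
    ∀ j < n, ∀ k < n + 2, (tableauProg.exec m).real 7 j k =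
      pivotTableau (m.real 7) u (σ (m.reg 1)) i j k := by
  intro j hj k hk
  set m₁ := principalPivotProg.exec m
  have h₁ : AgreeOff principalPivotProg.writes m m₁ := exec_agreeOff _ m
  have h₂ : AgreeOff shiftProg.writes m₁ (shiftProg.exec m₁) := exec_agreeOff _ m₁
  have hm₁ := hm.of_agreeOff h₁ (by decide)
  have hm₂ := hm₁.of_agreeOff h₂ (by decide)
  have hi₁ : m₁.reg 6 = i := (h₁.reg (by decide)).trans hi
  have hpivot : ∀ l < n + 2, m₁.real 6 j l = principalPivot (m.real 7) i j l :=
    fun l hl => hi ▸ exec_principalPivotProg m j (hm.size.symm ▸ hj) l (hm.size.symm ▸ hl)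
  calc (addColumnProg.exec (shiftProg.exec m₁)).real 7 j k
      = addColumn (m₁.real 6) i n (if σ (m.reg 1) i = Pos.basic then (u i).toReal else 0) j k := by
        rw [exec_addColumnProg _ j (hm₂.size.symm ▸ hj) k (hm₂.size.symm ▸ hk), hm₂.size,
          h₂.real (by decide), h₂.reg (by decide), hi₁, hm₁.exec_shiftProg hi₁,
          h₁.reg (by decide)]
    _ = pivotTableau (m.real 7) u (σ (m.reg 1)) i j k := by
        simp only [pivotTableau, addColumn, hpivot k hk, hpivot i (by omega)]

theorem Represents.exec_pivotProg (hm : Represents M q p u σ m) (hi : m.reg 6 = i) {κ : Kind}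
    (hupper : σ (m.reg 1) i ≠ Pos.upper) (hii : m.real 7 i i ≠ 0)
    (hpivot : Pivot M q p u κ (σ (m.reg 1))
      (Function.update (σ (m.reg 1)) i (σ (m.reg 1) i).next)) :
    Represents M q p u (Function.update σ (m.reg 1 + 1)
      (Function.update (σ (m.reg 1)) i (σ (m.reg 1) i).next)) (pivotProg.exec m) := by
  have h : AgreeOff pivotProg.writes m (pivotProg.exec m) := exec_agreeOff _ m
  have h₁ : AgreeOff tableauProg.writes m (tableauProg.exec m) := exec_agreeOff _ m
  have h₂ : AgreeOff recordProg.writes (tableauProg.exec m) (pivotProg.exec m) := exec_agreeOff _ _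
  have hreg : (pivotProg.exec m).reg 1 = m.reg 1 + 1 :=
    (exec_recordProg_reg _).trans (congrArg (· + 1) (h₁.reg (by decide)))
  constructor
  · exact (h.reg (by decide)).trans hm.size
  · exact (h.reg (by decide)).trans hm.result
  · simpa only [h.nat (a := 0) (by decide)] using hm.flag
  · simpa only [h.real (a := 3) (by decide)] using hm.bound
  · exact hreg ▸ hm.run.snoc hpivot
  · intro k hk j
    have hj : (j : ℕ) < (tableauProg.exec m).reg 0 := by
      rw [h₁.reg (by decide), hm.size]
      exact j.2
    refine (exec_recordProg_nat (tableauProg.exec m) k hj).trans ?_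
    rw [h₁.reg (v := 1) (by decide), h₁.reg (v := 6) (by decide), h₁.nat (a := 1) (by decide), hi]
    obtain rfl | hkN := eq_or_ne k (m.reg 1 + 1)
    · rw [if_pos rfl, Function.update_self, hm.status _ le_rfl]
      obtain rfl | hji := eq_or_ne j i
      · rw [if_pos rfl, Function.update_self, Pos.code_next hupper]
      · rw [if_neg (Fin.val_ne_of_ne hji), Function.update_of_ne hji, add_zero]
    · rw [if_neg hkN, Function.update_of_ne hkN, hm.status k (by omega)]
  · rw [hreg, Function.update_self, h₂.real (by decide)]
    exact (hm.tableau.pivot hupper hii).congr (hm.exec_tableauProg hi)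

theorem Represents.exec_stepProg_of_stopsOptimal (hm : Represents M q p u σ m)
    (hs : Regular M (σ (m.reg 1))) (hstopped : StopsOptimal M q p u (σ (m.reg 1))) :
    Represents M q p u σ (stepProg.exec m) ∧ (stepProg.exec m).reg 1 = m.reg 1 := by
  have h : AgreeOff selectProg.writes m (selectProg.exec m) := exec_agreeOff _ m
  have ht : (selectProg.exec m).real 5 0 0 = 0 := (hm.exec_selectProg hs).1.unique hstopped
  have hexec : stepProg.exec m = selectProg.exec m := by
    simp [stepProg, Prog.exec, Test.holds, RExp.eval, NExp.eval, ht]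
  rw [hexec]
  exact ⟨hm.of_agreeOff h (by decide), h.reg (by decide)⟩

theorem Represents.exec_stepProg_of_not_stopsOptimal (hM : M.PosSemidef)
    (hm : Represents M q (M *ᵥ d) u σ m) (hs : Regular M (σ (m.reg 1)))
    (hstopped : ¬ StopsOptimal M q (M *ᵥ d) u (σ (m.reg 1))) :
    (stepProg.exec m).reg 1 = m.reg 1 + 1 ∧
      ∃ σ', Represents M q (M *ᵥ d) u σ' (stepProg.exec m) := by
  set m₁ := selectProg.exec m
  have h : AgreeOff selectProg.writes m m₁ := exec_agreeOff _ m
  have hm₁ : Represents M q (M *ᵥ d) u σ m₁ := hm.of_agreeOff h (by decide)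
  have hreg : m₁.reg 1 = m.reg 1 := h.reg (by decide)
  obtain ⟨hcrit, hattained⟩ := hm.exec_selectProg hs
  have hne : m₁.real 5 0 0 ≠ 0 := fun ht =>
    hstopped (Eq.subst (motive := IsCritical M q (M *ᵥ d) u (σ (m.reg 1))) ht hcrit)
  have hpos : 0 < m₁.real 5 0 0 := hcrit.nonneg.lt_of_ne hne.symm
  obtain ⟨i, hi, hratio⟩ := hattained.resolve_left hne
  have hexec : stepProg.exec m = pivotProg.exec m₁ := by
    simp [stepProg, Prog.exec, Test.holds, RExp.eval, NExp.eval, hpos, m₁]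
  have hupper : σ (m.reg 1) i ≠ Pos.upper := by
    rcases lowerRatio_or_upperRatio (hratio.trans_ne hne) with h | h <;> simp [h.1]
  obtain ⟨κ, hpivot⟩ := exists_pivot_update_next hM hs hpos hcrit hratio
  have hii : m₁.real 7 i i ≠ 0 :=
    (hreg ▸ hm₁.tableau).diag_ne_zero hM hs (hratio.trans_ne hne)
  rw [← hreg] at hupper hpivot ⊢
  rw [hexec]
  exact ⟨(exec_recordProg_reg _).trans (congrArg (· + 1) ((exec_agreeOff _ _).reg (by decide))),
    _, hm₁.exec_pivotProg hi hupper hii hpivot⟩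

theorem exec_vectorProg (hm : m.real 8 = 0) : ∀ j < m.reg 0, (vectorProg.exec m).real 8 j 0 =
    ∑ l ∈ Finset.range (m.reg 0), m.real 0 j l * m.real 2 l 0 := by
  refine exec_accumulate hm fun m' hm' _ _ => ?_
  simp only [RExp.eval, NExp.eval, hm'.real (a := 0) (by decide), hm'.real (a := 2) (by decide)]

theorem exec_setupProg {m : Mem} (hm : m.real 8 = 0) : ∀ j < m.reg 0, ∀ k < m.reg 0 + 2,
    (setupProg.exec m).real 7 j k = if k < m.reg 0 then m.real 0 j k
      else if k = m.reg 0 then m.real 1 j 0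
      else ∑ l ∈ Finset.range (m.reg 0), m.real 0 j l * m.real 2 l 0 := by
  have hp : AgreeOff {.reg 3, .reg 4, .real 8} m (vectorProg.exec m) := exec_agreeOff vectorProg m
  refine exec_nested_of_eq_setReal (by decide) (hp.reg (by decide)) (fun m' hm' => ?_)
    fun m' hm' h3 _ => ?_
  · simp only [NExp.eval, hm'.reg (v := 0) (by decide), hp.reg (v := 0) (by decide)]
  · simp only [Prog.exec, Prog.put, Test.holds, RExp.eval, NExp.eval, ← exec_vectorProg hm _ h3,
      hm'.reg (v := 0) (by decide), hp.reg (v := 0) (by decide),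
      hm'.real (a := 0) (by decide), hp.real (a := 0) (by decide),
      hm'.real (a := 1) (by decide), hp.real (a := 1) (by decide), hm'.real (a := 8) (by decide)]
    split_ifs <;> rfl

theorem represents_setupProg (M : Matrix (Fin n) (Fin n) ℝ) (q d : Fin n → ℝ)
    (u : Fin n → EReal) : Represents M q (M *ᵥ d) u (fun _ => initial n)
      (setupProg.exec (inputMem M q d u)) := by
  have h : AgreeOff setupProg.writes (inputMem M q d u) (setupProg.exec (inputMem M q d u)) :=
    exec_agreeOff _ _
  have htableau := exec_setupProg (m := inputMem M q d u) rfl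
  have hreg : (setupProg.exec (inputMem M q d u)).reg 1 = 0 := h.reg (by decide)
  constructor
  · exact h.reg (by decide)
  · exact h.reg (by decide)
  · rw [h.nat (by decide)]
    simp [inputMem]
  · rw [h.real (by decide)]
    simp [inputMem, vecArray]
  · exact ⟨rfl, fun k hk => absurd hk (by simp [hreg])⟩
  · rw [h.nat (by decide)]
    simp [inputMem, initial, Pos.code]
  · refine isTableau_initial (fun i j => ?_) (fun i => ?_) fun i => ?_ <;>
      rw [htableau i i.2 _ (by simp [inputMem] <;> omega)]
    · simp [inputMem, matArray]
    · simp [inputMem, vecArray]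
    · simp [inputMem, Finset.sum_range, matArray, vecArray, mulVec, dotProduct]

theorem exists_represents_exec_loop_stepProg (hM : DiagDominant M d) (hu : ∀ i, 0 < u i)
    (h0 : Invariant M q (M *ᵥ d) u (initial n)) (hm : Represents M q (M *ᵥ d) u σ m)
    (hreg : m.reg 1 = 0) (he : e.eval m = N) :
    let m' := (Prog.loop 5 e stepProg).exec m
    ∃ σ', Represents M q (M *ᵥ d) u σ' m' ∧
      (m'.reg 1 = N ∨ StopsOptimal M q (M *ᵥ d) u (σ' (m'.reg 1))) := by
  refine exec_loop_induction (I := fun k m' => ∃ σ', Represents M q (M *ᵥ d) u σ' m' ∧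
    (m'.reg 1 = k ∨ StopsOptimal M q (M *ᵥ d) u (σ' (m'.reg 1)))) he ⟨σ, hm, Or.inl hreg⟩ ?_
  rintro k - m₁ - ⟨σ', hm₁, hk⟩
  have hm₂ : Represents M q (M *ᵥ d) u σ' (m₁.setReg 5 k) :=
    hm₁.of_agreeOff (agreeOff_setReg m₁ 5 k) (by decide)
  have hregular := (hm₂.run.invariant hM hu h0 _ le_rfl).1.regular
  by_cases hstopped : StopsOptimal M q (M *ᵥ d) u (σ' ((m₁.setReg 5 k).reg 1))
  · obtain ⟨hm₃, hreg₃⟩ := hm₂.exec_stepProg_of_stopsOptimal hregular hstopped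
    exact ⟨σ', hm₃, Or.inr (hreg₃ ▸ hstopped)⟩
  · obtain ⟨hreg₃, σ'', hm₃⟩ :=
      hm₂.exec_stepProg_of_not_stopsOptimal hM.posSemidef hregular hstopped
    exact ⟨σ'', hm₃, Or.inl (hreg₃.trans (congrArg (· + 1) (hk.resolve_right hstopped)))⟩

theorem documents_pppaProg (hM : DiagDominant M d) (hu : ∀ i, 0 < u i)
    (h0 : Invariant M q (M *ᵥ d) u (initial n)) :
    Documents M q (M *ᵥ d) u (pppaProg.exec (inputMem M q d u)) := by
  set m₀ := setupProg.exec (inputMem M q d u)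
  set m₁ := (Prog.loop 5 (.add (.reg 0) (.reg 0)) stepProg).exec m₀
  have hm₀ : Represents M q (M *ᵥ d) u _ m₀ := represents_setupProg M q d u
  have hreg₀ : m₀.reg 1 = 0 := (exec_agreeOff setupProg _).reg (by decide)
  obtain ⟨σ, hm₁, hlast⟩ := exists_represents_exec_loop_stepProg hM hu h0 hm₀ hreg₀
    (e := .add (.reg 0) (.reg 0)) (N := 2 * n) (by simp [NExp.eval, hm₀.size, two_mul])
  obtain ⟨hinv, -⟩ := hm₁.run.invariant hM hu h0 _ le_rfl
  have hstopped : StopsOptimal M q (M *ᵥ d) u (σ (m₁.reg 1)) := by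
    rcases stopsOptimal_or_exists_pivot hM.posSemidef hinv.regular with hstopped | ⟨κ, s, hpivot⟩
    · exact hstopped
    · refine hlast.resolve_left fun hN => ?_
      have hcode := ((hm₁.run.snoc hpivot).invariant hM hu h0 _ le_rfl).2
      exact absurd (hcode ▸ sum_code_le _) (by omega)
  have h : AgreeOff solutionProg.writes m₁ (pppaProg.exec (inputMem M q d u)) :=
    exec_agreeOff _ _
  refine ⟨σ, ?_⟩
  rw [h.reg (v := 1) (by decide), h.reg (v := 2) (by decide), h.nat (by decide)]
  exact ⟨hm₁.run, hm₁.status, Or.inl ⟨hm₁.result, hstopped, hm₁.exec_solutionProg hinv.regular⟩⟩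

end PPPA

theorem theorem6p1_general :
    ∃ (P : PPPA.Prog) (C : ℕ), ∀ (n : ℕ) (M : Matrix (Fin n) (Fin n) ℝ) (q d : Fin n → ℝ)
      (u : Fin n → EReal) (τ₀ : ℝ),
      0 < n → M.IsSymm → (∀ i, 0 < u i) → (∀ i, 0 < d i) →
      (∀ i, 0 ≤ (PPPA.comparison M).mulVec d i) → (∀ i, 0 ≤ q i + τ₀ * M.mulVec d i) →
      (∀ (N : ℕ) (σ : ℕ → PPPA.Status n), PPPA.IsRun M q (M.mulVec d) u N σ →
        N ≤ 2 * n ∧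
        (∀ k < N, ∀ κ, PPPA.Pivot M q (M.mulVec d) u κ (σ k) (σ (k + 1)) →
          κ = PPPA.Kind.toUpper ∨ κ = PPPA.Kind.enter) ∧
        IsUnit (PPPA.basicBlock M (σ N)).det ∧
        (PPPA.StopsOptimal M q (M.mulVec d) u (σ N) ∨
          PPPA.StopsUnbounded M q (M.mulVec d) u (σ N) ∨
          ∃ κ s, PPPA.Pivot M q (M.mulVec d) u κ (σ N) s) ∧
        (PPPA.StopsOptimal M q (M.mulVec d) u (σ N) →
          PPPA.IsOptimal M q u (PPPA.solution M q u (σ N))) ∧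
        (PPPA.StopsUnbounded M q (M.mulVec d) u (σ N) →
          (¬ ∃ x, PPPA.IsOptimal M q u x) ∧
          ¬ BddBelow (PPPA.objective M q '' PPPA.box u))) ∧
      PPPA.Documents M q (M.mulVec d) u (P.exec (PPPA.inputMem M q d u)) ∧
      P.cost (PPPA.inputMem M q d u) ≤ C * n ^ 3 := by
  obtain ⟨C, hC⟩ := PPPA.exists_cost_pppaProg_le
  refine ⟨PPPA.pppaProg, C, fun n M q d u τ₀ hn hsymm hu hd hMd hq => ?_⟩
  have hM : PPPA.DiagDominant M d := ⟨hsymm, hd, hMd⟩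
  have hp : ∀ i, 0 ≤ (M.mulVec d) i := fun i => (hMd i).trans <|
    PPPA.comparison_mulVec_le M (fun j => (abs_of_pos (hd j)).le) rfl
  have h0 : PPPA.Invariant M q (M.mulVec d) u (PPPA.initial n) :=
    PPPA.invariant_initial hu (le_max_right τ₀ 0) fun i => (hq i).trans <|
      add_le_add_right (mul_le_mul_of_nonneg_right (le_max_left τ₀ 0) (hp i)) _
  refine ⟨fun N σ hrun => ?_, PPPA.documents_pppaProg hM hu h0, ?_⟩
  · have hinv := hrun.invariant hM hu h0
    have hregular : ∀ k ≤ N, PPPA.Regular M (σ k) := fun k hk => (hinv k hk).1.regular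
    exact ⟨(hinv N le_rfl).2 ▸ PPPA.sum_code_le (σ N),
      fun k hk κ hpivot => hpivot.kind_eq hM.posSemidef (hregular k hk.le),
      hregular N le_rfl,
      (PPPA.stopsOptimal_or_exists_pivot hM.posSemidef (hregular N le_rfl)).imp_right Or.inr,
      (hinv N le_rfl).1.isOptimal hM.posSemidef hu (hM.bar_nonneg (hregular N le_rfl)),
      fun hstopped => absurd hstopped (PPPA.not_stopsUnbounded hM.posSemidef (hregular N le_rfl))⟩
  · exact hC (PPPA.inputMem M q d u) hn

theorem theorem6p1 :
    ∃ (P : PPPA.Prog) (C : ℕ), ∀ (n : ℕ) (M : Matrix (Fin n) (Fin n) ℝ) (q d : Fin n → ℝ)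
      (u : Fin n → EReal) (τ₀ : ℝ),
      0 < n → M.IsSymm → (PPPA.comparison M).PosSemidef → PPPA.IsIrreducible M →
      (∀ i, 0 < u i) → (∀ i, 0 < d i) → (PPPA.comparison M).mulVec d = 0 → 0 < τ₀ →
      (∀ i, 0 ≤ q i + τ₀ * M.mulVec d i) →
      -- every run of the algorithm, however ties are broken
      (∀ (N : ℕ) (σ : ℕ → PPPA.Status n), PPPA.IsRun M q (M.mulVec d) u N σ →
        -- at most `2n` pivots, all of them diagonal
        N ≤ 2 * n ∧
        (∀ k < N, ∀ κ, PPPA.Pivot M q (M.mulVec d) u κ (σ k) (σ (k + 1)) →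
          κ = PPPA.Kind.toUpper ∨ κ = PPPA.Kind.enter) ∧
        -- the linear systems of the next iteration are uniquely solvable
        IsUnit (PPPA.basicBlock M (σ N)).det ∧
        -- the algorithm stops or proceeds
        (PPPA.StopsOptimal M q (M.mulVec d) u (σ N) ∨
          PPPA.StopsUnbounded M q (M.mulVec d) u (σ N) ∨
          ∃ κ s, PPPA.Pivot M q (M.mulVec d) u κ (σ N) s) ∧
        -- what it reports when it stops is correct
        (PPPA.StopsOptimal M q (M.mulVec d) u (σ N) →
          PPPA.IsOptimal M q u (PPPA.solution M q u (σ N))) ∧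
        (PPPA.StopsUnbounded M q (M.mulVec d) u (σ N) →
          (¬ ∃ x, PPPA.IsOptimal M q u x) ∧
          ¬ BddBelow (PPPA.objective M q '' PPPA.box u))) ∧
      -- the algorithm is carried out by the program `P` in `O(n³)` steps
      PPPA.Documents M q (M.mulVec d) u (P.exec (PPPA.inputMem M q d u)) ∧
      P.cost (PPPA.inputMem M q d u) ≤ C * n ^ 3 := by
  obtain ⟨P, C, hP⟩ := theorem6p1_general
  exact ⟨P, C, fun n M q d u τ₀ hn hsymm _ _ hu hd hMd _ hq =>
    hP n M q d u τ₀ hn hsymm hu hd (fun i => (congrFun hMd i).ge) hq⟩
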